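/- Let $g_1,\dots,g_a\in\mathbb R[x_1,\dots,x_n]$ and $K=\{x\in\mathbb R^n : g_j(x)\ge 0 \text{ for all } j\}$. Let $\mathcal A$ be the set of functions $K\to\mathbb R$ obtained from polynomials by finitely many well-defined operations $+,\times,/,\vee,\wedge,|\cdot|,(\cdot)^{1/p}$ ($p\ge 1$ an integer). Let $f,h_1,\dots,h_s\in\mathcal A$, let $S=\{x\in K : h_l(x)\ge 0 \text{ for all } l\}$ be non-empty, and let $f^*=\inf_{x\in S} f(x)$. Suppose that polynomials $u_1,\dots,u_r\in\mathbb R[x,y]$ and $q_1,\dots,q_b\in\mathbb R[x,z]$, with $y\in\mathbb R^t$, $z\in\mathbb R^{m'}$, $m'\ge 1$, and index sets $J\subseteq\{1,\dots,t\}$, $J_f\subseteq\{1,\dots,m'\}$ give liftings of $S$ and of the graph of $f$: $$S=\{x\in K : \exists y,\ u_k(x,y)=0\ \forall k,\ y_j\ge 0\ \forall j\in J\},$$ $$\{(x,f(x)) : x\in K\}=\{(x,z_{m'}) : x\in K,\ q_\ell(x,z)=0\ \forall \ell,\ z_j\ge 0\ \forall j\in J_f\}.$$ Let $$\Omega=\{(x,y,z)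 : g_j(x)\ge 0,\ u_k(x,y)=0,\ q_\ell(x,z)=0\ \forall j,k,\ell;\ y_j\ge 0\ (j\in J),\ z_j\ge 0\ (j\in J_f)\},$$ let $M\in\mathbb R$ satisfy $M>\|(x,y,z)\|^2$ on $\Omega$, and let $\theta=M-\|(x,y,z)\|^2$. For a real sequence $w=(w_\alpha)$ indexed by the exponents of monomials in $(x,y,z)$ and a polynomial $p=\sum_\gamma p_\gamma X^\gamma$, let $p\,w$ be the sequence $(p\,w)_\alpha=\sum_\gamma p_\gamma w_{\alpha+\gamma}$, and let $M_k(w)=(w_{\alpha+\beta})_{|\alpha|,|\beta|\le k}$. Put $\delta(p)=\lceil \deg p/2\rceil$ and $c=\max\{1,\delta(g_j),\delta(u_k),\delta(q_\ell) : j,k,\ell\}$. For $i\ge c$ let $\rho_i$ be the optimal value of the semidefinite program that minimizes the moment $w_{z_{m'}}$ of the monomial $z_{m'}$ subject to $$M_i(w)\succeq 0,\quad M_{i-\delta(g_j)}(g_j w)\succeq 0,\quad M_{i-\delta(u_k)}(u_k w)=0,\quad M_{i-\delta(q_\ell)}(q_\ell w)=0\quad(\forall j,k,\ell),$$ $$M_{i-1}(y_j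 w)\succeq 0\ (j\in J),\quad M_{i-1}(z_j w)\succeq 0\ (j\in J_f),\quad M_{i-1}(\theta\, w)\succeq 0,\quad w_0=1.$$ Then $f^*$ is attained on $S$ and equals $\min\{z_{m'} : (x,y,z)\in\Omega\}$, each minimum $\rho_i$ ($i\ge c$) is attained, and: (a) the sequence $(\rho_i)_{i\ge c}$ is nondecreasing and $\rho_i\to f^*$ as $i\to\infty$; (b) if $i\ge c$ and $w$ is an optimal solution of the program of order $i$ with $\operatorname{rank} M_i(w)=\operatorname{rank} M_{i-c}(w)=d$, then $\rho_i=f^*$, and there is a probability measure with exactly $d$ atoms, supported on $d$ points of $\Omega$, whose moment of order $\alpha$ is $w_\alpha$ for all $|\alpha|\le 2i$. -/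

import Mathlib

open Filter Topology MeasureTheory

noncomputable section

namespace MomentRelaxation

/-- The algebra of functions on `K ⊆ ℝⁿ` generated from the polynomials by finitely many (well
defined) operations `+`, `×`, `/`, `∨`, `∧`, `|·|` and `(·)^{1/p}`. -/
inductive InAlgebra {n : ℕ} (K : Set (Fin n → ℝ)) : (K → ℝ) → Prop
  | poly (p : MvPolynomial (Fin n) ℝ) : InAlgebra K (fun x => MvPolynomial.eval x.1 p)
  | add {a b : K → ℝ} : InAlgebra K a → InAlgebra K b → InAlgebra K (fun x => a x + b x)
  | mul {a b : K → ℝ} : InAlgebra K a → InAlgebra K b → InAlgebra K (fun x => a x * b x)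
  | div {a b : K → ℝ} : InAlgebra K a → InAlgebra K b → (∀ x, b x ≠ 0) →
      InAlgebra K (fun x => a x / b x)
  | max {a b : K → ℝ} : InAlgebra K a → InAlgebra K b → InAlgebra K (fun x => max (a x) (b x))
  | min {a b : K → ℝ} : InAlgebra K a → InAlgebra K b → InAlgebra K (fun x => min (a x) (b x))
  | abs {a : K → ℝ} : InAlgebra K a → InAlgebra K (fun x => |a x|)
  | root {a : K → ℝ} (p : ℕ) : 1 ≤ p → InAlgebra K a → (∀ x, 0 ≤ a x) →
      InAlgebra K (fun x => (a x) ^ (1 / (p : ℝ)))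

/-! ### Moment and localizing matrices -/

/-- Exponents of total degree at most `k`: the row and column index set of `M_k`. -/
abbrev MonoLE (σ : Type) (k : ℕ) : Type := {α : σ →₀ ℕ // α.degree ≤ k}

instance monoLEFintype (σ : Type) [Finite σ] (k : ℕ) : Fintype (MonoLE σ k) :=
  (Finsupp.finite_of_degree_le (σ := σ) k).fintype

/-- The moment matrix `M_k(w)`, with entries `w_{α+β}` for `|α|, |β| ≤ k`. -/
def momentMatrix {σ : Type} (k : ℕ) (w : (σ →₀ ℕ) → ℝ) :
    Matrix (MonoLE σ k) (MonoLE σ k) ℝ :=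
  Matrix.of fun α β => w (α.1 + β.1)

/-- The shifted sequence `p w`, with `(p w)_α = ∑_γ p_γ w_{α+γ}`; the matrix `M_k(p w)` is the
localizing matrix of `p`. -/
def shift {σ : Type} (p : MvPolynomial σ ℝ) (w : (σ →₀ ℕ) → ℝ) : (σ →₀ ℕ) → ℝ :=
  fun α => ∑ γ ∈ p.support, p.coeff γ * w (α + γ)

/-- `⌈deg p / 2⌉`. -/
def halfDeg {σ : Type} (p : MvPolynomial σ ℝ) : ℕ := (p.totalDegree + 1) / 2

/-! ### The lifted polynomial problem -/

/-- Variables `(x, y, z)` of the lifted space, with `x ∈ ℝⁿ`, `y ∈ ℝᵗ`, `z ∈ ℝᵐ⁺¹`. -/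
abbrev Var (n t m : ℕ) : Type := Fin n ⊕ (Fin t ⊕ Fin (m + 1))

/-- The polynomial data of a lifted problem: `g_j(x)` describes `K`; `u_k(x,y)` and `J` describe
a lifting of the feasible set; `q_ℓ(x,z)` and `Jf` describe a lifting of the objective function,
whose value is the last coordinate of `z`; `M` is the constant of the ball constraint. -/
structure LiftedData (n t m a r b : ℕ) where
  g : Fin a → MvPolynomial (Fin n) ℝ
  u : Fin r → MvPolynomial (Fin n ⊕ Fin t) ℝ
  J : Finset (Fin t)
  q : Fin b → MvPolynomial (Fin n ⊕ Fin (m + 1)) ℝ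
  Jf : Finset (Fin (m + 1))
  M : ℝ

namespace LiftedData

variable {n t m a r b : ℕ} (D : LiftedData n t m a r b)

/-- The basic semi-algebraic set `K = {x : g_j(x) ≥ 0}`. -/
def K : Set (Fin n → ℝ) := {x | ∀ j, 0 ≤ MvPolynomial.eval x (D.g j)}

/-- The projection `{x ∈ K : ∃ y, u_k(x,y) = 0 for all k, y_j ≥ 0 for j ∈ J}`. -/
def projectedSet : Set D.K :=
  {x | ∃ y : Fin t → ℝ, (∀ k, MvPolynomial.eval (Sum.elim x.1 y) (D.u k) = 0) ∧
    ∀ j ∈ D.J, 0 ≤ y j}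

/-- The set of all `(x, z_{last})` with `x ∈ K`, `q_ℓ(x,z) = 0` for all `ℓ`, and `z_j ≥ 0` for
`j ∈ Jf`. -/
def projectedGraph : Set (D.K × ℝ) :=
  {p | ∃ z : Fin (m + 1) → ℝ, z (Fin.last m) = p.2 ∧
    (∀ l, MvPolynomial.eval (Sum.elim p.1.1 z) (D.q l) = 0) ∧ ∀ j ∈ D.Jf, 0 ≤ z j}

/-- `g_j` seen in `ℝ[x,y,z]`. -/
def gLift (j : Fin a) : MvPolynomial (Var n t m) ℝ := MvPolynomial.rename Sum.inl (D.g j)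

/-- `u_k` seen in `ℝ[x,y,z]`. -/
def uLift (k : Fin r) : MvPolynomial (Var n t m) ℝ :=
  MvPolynomial.rename (Sum.map id Sum.inl) (D.u k)

/-- `q_ℓ` seen in `ℝ[x,y,z]`. -/
def qLift (l : Fin b) : MvPolynomial (Var n t m) ℝ :=
  MvPolynomial.rename (Sum.map id Sum.inr) (D.q l)

/-- The variable `y_j`. -/
def yVar (n m : ℕ) {t : ℕ} (j : Fin t) : Var n t m := Sum.inr (Sum.inl j)

/-- The variable `z_j`. -/
def zVar (n t : ℕ) {m : ℕ} (j : Fin (m + 1)) : Var n t m := Sum.inr (Sum.inr j)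

/-- The basic semi-algebraic set `Ω` of the lifted space. -/
def Omega : Set (Var n t m → ℝ) :=
  {v | (∀ j, 0 ≤ MvPolynomial.eval v (D.gLift j)) ∧
    (∀ k, MvPolynomial.eval v (D.uLift k) = 0) ∧
    (∀ l, MvPolynomial.eval v (D.qLift l) = 0) ∧
    (∀ j ∈ D.J, 0 ≤ v (yVar n m j)) ∧
    (∀ j ∈ D.Jf, 0 ≤ v (zVar n t j))}

/-- `θ(x,y,z) = M - ‖(x,y,z)‖²`. -/
def theta : MvPolynomial (Var n t m) ℝ :=
  MvPolynomial.C D.M - ∑ s, MvPolynomial.X s ^ 2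

/-- The largest half-degree of a constraint polynomial (`y_j`, `z_j` and `θ` have half-degree
`1`). It is both the first relaxation order and the rank gap in the flatness condition. -/
def c : ℕ :=
  max 1 (max (Finset.univ.sup fun j => halfDeg (D.g j))
    (max (Finset.univ.sup fun k => halfDeg (D.u k)) (Finset.univ.sup fun l => halfDeg (D.q l))))

/-- The objective of the relaxation: the first-order moment of the last variable `z_{last}`. -/
def objective (w : (Var n t m →₀ ℕ) → ℝ) : ℝ :=
  w (Finsupp.single (zVar n t (Fin.last m)) 1)

/-- Feasibility of `w` for the semidefinite relaxation of order `i`. -/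
structure Feasible (i : ℕ) (w : (Var n t m →₀ ℕ) → ℝ) : Prop where
  moment : (momentMatrix i w).PosSemidef
  loc_g : ∀ j, (momentMatrix (i - halfDeg (D.g j)) (shift (D.gLift j) w)).PosSemidef
  loc_u : ∀ k, momentMatrix (i - halfDeg (D.u k)) (shift (D.uLift k) w) = 0
  loc_q : ∀ l, momentMatrix (i - halfDeg (D.q l)) (shift (D.qLift l) w) = 0
  loc_y : ∀ j ∈ D.J, (momentMatrix (i - 1) (shift (MvPolynomial.X (yVar n m j)) w)).PosSemidef
  loc_z : ∀ j ∈ D.Jf, (momentMatrix (i - 1) (shift (MvPolynomial.X (zVar n t j)) w)).PosSemidef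
  loc_theta : (momentMatrix (i - 1) (shift D.theta w)).PosSemidef
  mass : w 0 = 1

/-- `w` is an optimal solution of the relaxation of order `i`. -/
def IsOptimal (i : ℕ) (w : (Var n t m →₀ ℕ) → ℝ) : Prop :=
  D.Feasible i w ∧ ∀ w', D.Feasible i w' → objective w ≤ objective w'

/-- The optimal value `ρ_i` of the relaxation of order `i`. -/
def rho (i : ℕ) : ℝ := sInf (objective '' {w | D.Feasible i w})

end LiftedData

/-- `μ` is a probability measure with exactly `d` atoms, all in `A`, and no mass elsewhere. -/
def IsAtomicProbability {E : Type} [MeasurableSpace E] (μ : Measure E) (d : ℕ) (A : Set E) :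
    Prop :=
  IsProbabilityMeasure μ ∧ ∃ T : Finset E, T.card = d ∧ (T : Set E) ⊆ A ∧
    (∀ x ∈ T, 0 < μ {x}) ∧ μ (T : Set E)ᶜ = 0

end MomentRelaxation

end

noncomputable section

namespace MomentRelaxation

open MvPolynomial

section Riesz

variable {σ : Type}

/-- The Riesz functional `X^γ ↦ w_γ` of a real sequence. -/
def riesz (w : (σ →₀ ℕ) → ℝ) : MvPolynomial σ ℝ →ₗ[ℝ] ℝ :=
  (basisMonomials σ ℝ).constr ℝ w

theorem riesz_monomial_one (w : (σ →₀ ℕ) → ℝ) (γ : σ →₀ ℕ) : riesz w (monomial γ 1) = w γ := by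
  have := (basisMonomials σ ℝ).constr_basis ℝ w γ
  rwa [coe_basisMonomials] at this

theorem monomial_eq_smul_one (γ : σ →₀ ℕ) (a : ℝ) : monomial γ a = a • monomial γ (1 : ℝ) := by
  rw [smul_monomial, smul_eq_mul, mul_one]

theorem riesz_monomial (w : (σ →₀ ℕ) → ℝ) (γ : σ →₀ ℕ) (a : ℝ) :
    riesz w (monomial γ a) = a * w γ := by
  rw [monomial_eq_smul_one, map_smul, riesz_monomial_one, smul_eq_mul]

theorem riesz_one (w : (σ →₀ ℕ) → ℝ) : riesz w 1 = w 0 := riesz_monomial_one w 0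

theorem riesz_X (w : (σ →₀ ℕ) → ℝ) (s : σ) : riesz w (X s) = w (Finsupp.single s 1) :=
  riesz_monomial_one w _

theorem riesz_apply (w : (σ →₀ ℕ) → ℝ) (p : MvPolynomial σ ℝ) :
    riesz w p = ∑ γ ∈ p.support, p.coeff γ * w γ := by
  conv_lhs => rw [p.as_sum, map_sum]
  exact Finset.sum_congr rfl fun γ _ => riesz_monomial w γ _

theorem linearMap_eq_riesz (L : MvPolynomial σ ℝ →ₗ[ℝ] ℝ) :
    riesz (fun γ => L (monomial γ 1)) = L := by
  refine (basisMonomials σ ℝ).ext fun γ => ?_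
  rw [coe_basisMonomials]
  exact riesz_monomial_one _ γ

theorem continuous_riesz (p : MvPolynomial σ ℝ) :
    Continuous fun w : (σ →₀ ℕ) → ℝ => riesz w p := by
  simp only [riesz_apply]
  fun_prop

theorem riesz_mul_monomial_one (w : (σ →₀ ℕ) → ℝ) (p : MvPolynomial σ ℝ) (α : σ →₀ ℕ) :
    riesz w (p * monomial α 1) = shift p w α := by
  conv_lhs => rw [p.as_sum, Finset.sum_mul, map_sum]
  refine Finset.sum_congr rfl fun γ _ => ?_
  rw [monomial_mul, riesz_monomial, mul_one, add_comm]

theorem shift_one (w : (σ →₀ ℕ) → ℝ) : shift 1 w = w := by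
  funext α
  rw [← riesz_mul_monomial_one, one_mul, riesz_monomial_one]

theorem degree_le_totalDegree {p : MvPolynomial σ ℝ} {γ : σ →₀ ℕ} (h : γ ∈ p.support) :
    γ.degree ≤ p.totalDegree := le_totalDegree h

theorem totalDegree_monomial_le_degree (γ : σ →₀ ℕ) (a : ℝ) :
    (monomial γ a).totalDegree ≤ γ.degree := totalDegree_monomial_le γ a

/-- Linear maps that agree on the monomials of degree at most `k` agree on the polynomials of
degree at most `k`. -/
theorem linearMap_eq_of_totalDegree_le {E : Type*} [AddCommGroup E] [Module ℝ E]
    {A B : MvPolynomial σ ℝ →ₗ[ℝ] E} {k : ℕ}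
    (h : ∀ γ : σ →₀ ℕ, γ.degree ≤ k → A (monomial γ 1) = B (monomial γ 1))
    {p : MvPolynomial σ ℝ} (hp : p.totalDegree ≤ k) : A p = B p := by
  rw [p.as_sum, map_sum, map_sum]
  refine Finset.sum_congr rfl fun γ hγ => ?_
  rw [monomial_eq_smul_one, map_smul, map_smul, h γ ((degree_le_totalDegree hγ).trans hp)]

theorem exists_add_eq_of_degree_le {γ : σ →₀ ℕ} {k l : ℕ} (h : γ.degree ≤ k + l) :
    ∃ α β : σ →₀ ℕ, α + β = γ ∧ α.degree ≤ k ∧ β.degree ≤ l := by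
  obtain ⟨α, hα, hd⟩ := Finsupp.exists_le_degree_eq γ (min k γ.degree) (min_le_right _ _)
  refine ⟨α, γ - α, add_tsub_cancel_of_le hα, hd.trans_le (min_le_left _ _), ?_⟩
  have := congrArg Finsupp.degree (add_tsub_cancel_of_le hα)
  rw [map_add] at this
  omega

theorem momentMatrix_shift_eq_zero_iff {k : ℕ} {w : (σ →₀ ℕ) → ℝ} {p : MvPolynomial σ ℝ} :
    momentMatrix k (shift p w) = 0 ↔ (momentMatrix k (shift p w)).PosSemidef ∧
      (momentMatrix k (shift (-p) w)).PosSemidef := by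
  have hneg : momentMatrix k (shift (-p) w) = -momentMatrix k (shift p w) := by
    ext α β
    simp only [momentMatrix, Matrix.of_apply, Matrix.neg_apply, ← riesz_mul_monomial_one, neg_mul,
      map_neg]
  rw [hneg]
  refine ⟨fun h => by simp [h, Matrix.PosSemidef.zero], fun ⟨h₁, h₂⟩ => ?_⟩
  open scoped MatrixOrder in
  exact le_antisymm (neg_nonneg.1 (Matrix.nonneg_iff_posSemidef.2 h₂))
    (Matrix.nonneg_iff_posSemidef.2 h₁)

variable [Finite σ]

theorem eq_sum_monoLE {k : ℕ} {q : MvPolynomial σ ℝ} (hq : q.totalDegree ≤ k) :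
    q = ∑ α : MonoLE σ k, monomial α.1 (q.coeff α.1) := by
  classical
  ext γ
  rw [coeff_sum]
  simp only [coeff_monomial]
  by_cases hγ : γ.degree ≤ k
  · rw [Finset.sum_eq_single (⟨γ, hγ⟩ : MonoLE σ k)]
    · simp
    · intro b _ hb
      exact if_neg fun h => hb (Subtype.ext h)
    · simp
  · rw [Finset.sum_eq_zero, ← notMem_support_iff]
    · exact fun h => hγ ((degree_le_totalDegree h).trans hq)
    · intro b _
      exact if_neg fun h : b.1 = γ => hγ (h ▸ b.2)

theorem riesz_mul_sum_mul_sum {k : ℕ} (w : (σ →₀ ℕ) → ℝ) (p : MvPolynomial σ ℝ)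
    (x y : MonoLE σ k → ℝ) :
    riesz w (p * ((∑ α, monomial α.1 (x α)) * ∑ β, monomial β.1 (y β))) =
      dotProduct x ((momentMatrix k (shift p w)).mulVec y) := by
  rw [Finset.sum_mul_sum, Finset.mul_sum, map_sum]
  refine Finset.sum_congr rfl fun α _ => ?_
  rw [Finset.mul_sum, map_sum, Matrix.mulVec, dotProduct, Finset.mul_sum]
  refine Finset.sum_congr rfl fun β _ => ?_
  rw [monomial_mul, monomial_eq_smul_one, mul_smul_comm, map_smul, riesz_mul_monomial_one,
    smul_eq_mul, momentMatrix, Matrix.of_apply]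
  ring

theorem totalDegree_sum_monoLE {k : ℕ} (x : MonoLE σ k → ℝ) :
    (∑ α, monomial α.1 (x α) : MvPolynomial σ ℝ).totalDegree ≤ k :=
  totalDegree_finsetSum_le fun α _ => (totalDegree_monomial_le_degree _ _).trans α.2

/-- A localizing matrix is positive semidefinite iff the functional is nonnegative on the
corresponding multiples of squares. -/
theorem momentMatrix_shift_posSemidef_iff {k : ℕ} {w : (σ →₀ ℕ) → ℝ} {p : MvPolynomial σ ℝ} :
    (momentMatrix k (shift p w)).PosSemidef ↔
      ∀ q : MvPolynomial σ ℝ, q.totalDegree ≤ k → 0 ≤ riesz w (p * (q * q)) := by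
  rw [Matrix.posSemidef_iff_dotProduct_mulVec]
  constructor
  · rintro ⟨-, h⟩ q hq
    rw [eq_sum_monoLE hq, riesz_mul_sum_mul_sum]
    exact h _
  · refine fun h => ⟨?_, fun x => ?_⟩
    · ext α β
      simp [momentMatrix, add_comm]
    · have := h _ (totalDegree_sum_monoLE x)
      rwa [riesz_mul_sum_mul_sum] at this

end Riesz

theorem finsupp_induction_add_single {σ : Type} {P : (σ →₀ ℕ) → Prop} (zero : P 0)
    (add : ∀ α s, P α → P (α + Finsupp.single s 1)) (α : σ →₀ ℕ) : P α := by
  induction α using Finsupp.induction₂ with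
  | zero => exact zero
  | add_single s n α _ _ h =>
    clear * - h add
    induction n with
    | zero => simpa using h
    | succ n ih => simpa only [Finsupp.single_add, add_assoc] using add _ s ih

/-- `w` is normalized and satisfies the semidefinite constraints of order `i` given by the set `Q`
of polynomials (each one coming with the order it costs). -/
structure SatisfiesUpTo {σ : Type} (Q : Set (MvPolynomial σ ℝ × ℕ)) (i : ℕ)
    (w : (σ →₀ ℕ) → ℝ) : Prop where
  mass : w 0 = 1
  nonneg : ∀ p k, (p, k) ∈ Q → ∀ q : MvPolynomial σ ℝ, q.totalDegree + k ≤ i →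
    0 ≤ riesz w (p * (q * q))

/-- The ball constraint `R - ‖X‖²`. -/
def ballPoly (σ : Type) [Fintype σ] (R : ℝ) : MvPolynomial σ ℝ := C R - ∑ s, X s ^ 2

/-- The set described by the constraints `Q`. -/
def solutionSet {σ : Type} (Q : Set (MvPolynomial σ ℝ × ℕ)) : Set (σ → ℝ) :=
  {v | ∀ p k, (p, k) ∈ Q → 0 ≤ eval v p}

namespace SatisfiesUpTo

variable {σ : Type} {Q : Set (MvPolynomial σ ℝ × ℕ)} {i : ℕ} {w : (σ →₀ ℕ) → ℝ}

theorem mono {j : ℕ} (hw : SatisfiesUpTo Q j w) (hij : i ≤ j) : SatisfiesUpTo Q i w :=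
  ⟨hw.mass, fun p k hp q hq => hw.nonneg p k hp q (hq.trans hij)⟩

theorem sq_nonneg (hw : SatisfiesUpTo Q i w) (h1 : (1, 0) ∈ Q) {q : MvPolynomial σ ℝ}
    (hq : q.totalDegree ≤ i) : 0 ≤ riesz w (q * q) := by
  simpa using hw.nonneg 1 0 h1 q (by simpa using hq)

theorem even_nonneg (hw : SatisfiesUpTo Q i w) (h1 : (1, 0) ∈ Q) {α : σ →₀ ℕ}
    (hα : α.degree ≤ i) : 0 ≤ w (α + α) := by
  have := hw.sq_nonneg h1 ((totalDegree_monomial_le_degree α 1).trans hα)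
  rwa [monomial_mul, mul_one, riesz_monomial_one] at this

theorem two_mul_abs_le (hw : SatisfiesUpTo Q i w) (h1 : (1, 0) ∈ Q) {α β : σ →₀ ℕ}
    (hα : α.degree ≤ i) (hβ : β.degree ≤ i) :
    2 * |w (α + β)| ≤ w (α + α) + w (β + β) := by
  have key : ∀ a : ℝ, 0 ≤ w (α + α) + 2 * a * w (α + β) + a * a * w (β + β) := by
    intro a
    have hd : (monomial α 1 + monomial β a : MvPolynomial σ ℝ).totalDegree ≤ i :=
      (totalDegree_add _ _).trans (max_le ((totalDegree_monomial_le_degree _ _).trans hα)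
        ((totalDegree_monomial_le_degree _ _).trans hβ))
    have := hw.sq_nonneg h1 hd
    rw [add_mul, mul_add, mul_add, monomial_mul, monomial_mul, monomial_mul, monomial_mul] at this
    simp only [map_add, riesz_monomial, add_comm β α] at this
    linarith
  rcases abs_cases (w (α + β)) with h | h
  · linarith [key (-1)]
  · linarith [key 1]

variable [Fintype σ]

theorem even_le (hw : SatisfiesUpTo Q i w) (h1 : (1, 0) ∈ Q) {R : ℝ}
    (hR : (ballPoly σ R, 1) ∈ Q) (α : σ →₀ ℕ) (hα : α.degree ≤ i) :
    w (α + α) ≤ max 1 R ^ α.degree := by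
  induction α using finsupp_induction_add_single with
  | zero => simp [hw.mass]
  | add α s ih =>
    rw [map_add, Finsupp.degree_single] at hα ⊢
    have hn := hw.nonneg _ _ hR (monomial α 1)
      ((Nat.add_le_add_right (totalDegree_monomial_le_degree α 1) 1).trans hα)
    have hexp : riesz w (ballPoly σ R * (monomial α 1 * monomial α 1)) =
        R * w (α + α) - ∑ r, w ((α + Finsupp.single r 1) + (α + Finsupp.single r 1)) := by
      rw [ballPoly, sub_mul, map_sub, monomial_mul, mul_one, C_mul', map_smul,
        riesz_monomial_one, Finset.sum_mul, map_sum, smul_eq_mul]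
      congr 1
      refine Finset.sum_congr rfl fun r _ => ?_
      rw [X_pow_eq_monomial, monomial_mul, mul_one, riesz_monomial_one]
      congr 1
      rw [add_add_add_comm, ← Finsupp.single_add, add_comm]
    have hs : w ((α + Finsupp.single s 1) + (α + Finsupp.single s 1)) ≤
        ∑ r, w ((α + Finsupp.single r 1) + (α + Finsupp.single r 1)) :=
      Finset.single_le_sum
        (f := fun r => w ((α + Finsupp.single r 1) + (α + Finsupp.single r 1)))
        (fun r _ => hw.even_nonneg h1 (by rwa [map_add, Finsupp.degree_single]))
        (Finset.mem_univ s)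
    have h0 := hw.even_nonneg h1 (α := α) (by omega)
    have hi := ih (by omega)
    calc _ ≤ R * w (α + α) := by linarith
      _ ≤ max 1 R * w (α + α) := by gcongr; exact le_max_right _ _
      _ ≤ max 1 R * max 1 R ^ α.degree := by gcongr
      _ = _ := by rw [pow_succ']

/-- Under a ball constraint the moments of degree at most `2i` of a feasible point of order `i`
are bounded by a constant independent of `i`. -/
theorem abs_le (hw : SatisfiesUpTo Q i w) (h1 : (1, 0) ∈ Q) {R : ℝ}
    (hR : (ballPoly σ R, 1) ∈ Q) (γ : σ →₀ ℕ) (hγ : γ.degree ≤ 2 * i) :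
    |w γ| ≤ max 1 R ^ γ.degree := by
  obtain ⟨α, β, rfl, hα, hβ⟩ :=
    exists_add_eq_of_degree_le (γ := γ) (k := (γ.degree + 1) / 2) (l := γ.degree / 2) (by omega)
  set n := (α + β).degree
  have h := hw.two_mul_abs_le h1 (α := α) (β := β) (by omega) (by omega)
  have ha : w (α + α) ≤ max 1 R ^ n := (hw.even_le h1 hR α (by omega)).trans
    (pow_le_pow_right₀ (le_max_left _ _) (by omega))
  have hb : w (β + β) ≤ max 1 R ^ n := (hw.even_le h1 hR β (by omega)).trans
    (pow_le_pow_right₀ (le_max_left _ _) (by omega))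
  linarith

end SatisfiesUpTo

/-- Evaluation at a point that satisfies the constraints is feasible. -/
theorem satisfiesUpTo_eval {σ : Type} {Q : Set (MvPolynomial σ ℝ × ℕ)} {v : σ → ℝ}
    (hv : v ∈ solutionSet Q) (i : ℕ) :
    SatisfiesUpTo Q i fun γ => eval v (monomial γ (1 : ℝ)) := by
  have h : riesz (fun γ => eval v (monomial γ (1 : ℝ))) = (aeval v).toLinearMap :=
    linearMap_eq_riesz (aeval v).toLinearMap
  refine ⟨by simp, fun p k hp q _ => ?_⟩
  rw [h]
  simp only [AlgHom.toLinearMap_apply, map_mul]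
  exact mul_nonneg (hv p k hp) (mul_self_nonneg _)

/-! ### Truncation and compactness -/

/-- The moments of order larger than `k` are replaced by zero. -/
def truncate {σ : Type} (k : ℕ) (w : (σ →₀ ℕ) → ℝ) : (σ →₀ ℕ) → ℝ :=
  fun γ => if γ.degree ≤ k then w γ else 0

theorem truncate_apply {σ : Type} {k : ℕ} (w : (σ →₀ ℕ) → ℝ) {γ : σ →₀ ℕ} (hγ : γ.degree ≤ k) :
    truncate k w γ = w γ := if_pos hγ

theorem riesz_truncate {σ : Type} {k : ℕ} (w : (σ →₀ ℕ) → ℝ) {p : MvPolynomial σ ℝ}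
    (hp : p.totalDegree ≤ k) : riesz (truncate k w) p = riesz w p :=
  linearMap_eq_of_totalDegree_le
    (fun γ hγ => by rw [riesz_monomial_one, riesz_monomial_one, truncate_apply w hγ]) hp

theorem totalDegree_mul_mul_self_le {σ : Type} {p q : MvPolynomial σ ℝ} {i k : ℕ}
    (hp : p.totalDegree ≤ 2 * k) (hq : q.totalDegree + k ≤ i) :
    (p * (q * q)).totalDegree ≤ 2 * i := by
  have h₁ := totalDegree_mul p (q * q)
  have h₂ := totalDegree_mul q q
  omega

theorem SatisfiesUpTo.truncate {σ : Type} {Q : Set (MvPolynomial σ ℝ × ℕ)} {i : ℕ}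
    {w : (σ →₀ ℕ) → ℝ} (hdeg : ∀ p k, (p, k) ∈ Q → p.totalDegree ≤ 2 * k)
    (hw : SatisfiesUpTo Q i w) : SatisfiesUpTo Q i (truncate (2 * i) w) where
  mass := (truncate_apply w (by simp)).trans hw.mass
  nonneg p k hp q hq := by
    rw [riesz_truncate w (totalDegree_mul_mul_self_le (hdeg p k hp) hq)]
    exact hw.nonneg p k hp q hq

/-- The box of sequences that are bounded by `B ^ |γ|`. -/
def momentBox (σ : Type) (B : ℝ) : Set ((σ →₀ ℕ) → ℝ) :=
  Set.univ.pi fun γ => Set.Icc (-(B ^ γ.degree)) (B ^ γ.degree)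

theorem isCompact_momentBox (σ : Type) (B : ℝ) : IsCompact (momentBox σ B) :=
  isCompact_univ_pi fun _ => isCompact_Icc

theorem mem_momentBox {σ : Type} {B : ℝ} {w : (σ →₀ ℕ) → ℝ} :
    w ∈ momentBox σ B ↔ ∀ γ, |w γ| ≤ B ^ γ.degree := by
  simp only [momentBox, Set.mem_univ_pi, Set.mem_Icc, abs_le]

theorem isClosed_setOf_satisfiesUpTo {σ : Type} (Q : Set (MvPolynomial σ ℝ × ℕ)) (i : ℕ) :
    IsClosed {w | SatisfiesUpTo Q i w} := by
  have : {w | SatisfiesUpTo Q i w} = {w : (σ →₀ ℕ) → ℝ | w 0 = 1} ∩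
      ⋂ (p : MvPolynomial σ ℝ) (k : ℕ) (_ : (p, k) ∈ Q) (q : MvPolynomial σ ℝ)
        (_ : q.totalDegree + k ≤ i), {w | 0 ≤ riesz w (p * (q * q))} := by
    ext w
    simp only [Set.mem_ofPred_eq, Set.mem_inter_iff, Set.mem_iInter]
    exact ⟨fun h => ⟨h.1, h.2⟩, fun h => ⟨h.1, h.2⟩⟩
  rw [this]
  refine (isClosed_eq (continuous_apply 0) continuous_const).inter ?_
  exact isClosed_iInter fun p => isClosed_iInter fun k => isClosed_iInter fun _ =>
    isClosed_iInter fun q => isClosed_iInter fun _ =>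
      isClosed_le continuous_const (continuous_riesz _)

theorem SatisfiesUpTo.truncate_mem_momentBox {σ : Type} [Fintype σ]
    {Q : Set (MvPolynomial σ ℝ × ℕ)} {i : ℕ}
    {w : (σ →₀ ℕ) → ℝ} {R : ℝ} (h1 : (1, 0) ∈ Q) (hR : (ballPoly σ R, 1) ∈ Q)
    (hw : SatisfiesUpTo Q i w) :
    MomentRelaxation.truncate (2 * i) w ∈ momentBox σ (max 1 R) := by
  refine mem_momentBox.2 fun γ => ?_
  by_cases hγ : γ.degree ≤ 2 * i
  · rw [truncate_apply w hγ]
    exact hw.abs_le h1 hR γ hγ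
  · rw [MomentRelaxation.truncate, if_neg hγ, abs_zero]
    exact pow_nonneg (zero_le_one.trans (le_max_left _ _)) _

/-- The relaxation of order `i` attains its minimum. -/
theorem exists_isLeast_satisfiesUpTo {σ : Type} [Fintype σ]
    {Q : Set (MvPolynomial σ ℝ × ℕ)} {i : ℕ} {R : ℝ}
    (hdeg : ∀ p k, (p, k) ∈ Q → p.totalDegree ≤ 2 * k)
    (h1 : (1, 0) ∈ Q) (hR : (ballPoly σ R, 1) ∈ Q) (hne : (solutionSet Q).Nonempty)
    {γ : σ →₀ ℕ} (hγ : γ.degree ≤ 2 * i) :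
    ∃ w, SatisfiesUpTo Q i w ∧ ∀ w', SatisfiesUpTo Q i w' → w γ ≤ w' γ := by
  obtain ⟨v, hv⟩ := hne
  have hcomp : IsCompact (momentBox σ (max 1 R) ∩ {w | SatisfiesUpTo Q i w}) :=
    (isCompact_momentBox σ _).inter_right (isClosed_setOf_satisfiesUpTo Q i)
  have hmem : ∀ w, SatisfiesUpTo Q i w →
      truncate (2 * i) w ∈ momentBox σ (max 1 R) ∩ {w | SatisfiesUpTo Q i w} :=
    fun w hw => ⟨hw.truncate_mem_momentBox h1 hR, hw.truncate hdeg⟩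
  obtain ⟨w, hw, hmin⟩ := hcomp.exists_isMinOn ⟨_, hmem _ (satisfiesUpTo_eval hv i)⟩
    (continuous_apply γ).continuousOn
  refine ⟨w, hw.2, fun w' hw' => ?_⟩
  rw [← truncate_apply w' hγ]
  exact isMinOn_iff.1 hmin _ (hmem w' hw')

/-! ### Functionals that are nonnegative on squares -/

section Functional

variable {σ : Type} {L : MvPolynomial σ ℝ →ₗ[ℝ] ℝ}

theorem cauchySchwarz_of_sq_nonneg (hL : ∀ q, 0 ≤ L (q * q)) (p q : MvPolynomial σ ℝ) :
    L (p * q) ^ 2 ≤ L (p * p) * L (q * q) := by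
  have key : ∀ a : ℝ, 0 ≤ L (q * q) * (a * a) + 2 * L (p * q) * a + L (p * p) := by
    intro a
    have h := hL (a • q + p)
    have he : (a • q + p) * (a • q + p) =
        (a * a) • (q * q) + (2 * a) • (p * q) + p * p := by
      simp only [smul_eq_C_mul, map_mul, map_ofNat]
      ring
    rw [he, map_add, map_add, map_smul, map_smul, smul_eq_mul, smul_eq_mul] at h
    linarith
  have := discrim_le_zero key
  rw [discrim] at this
  linarith

/-- If the moments `L(s^{2N} p²)` grow at most like `B^{2N}`, then multiplication by `s` is bounded
by `B` at `p`. -/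
theorem sq_mul_le_of_growth (hL : ∀ q, 0 ≤ L (q * q)) {s p : MvPolynomial σ ℝ} {B C : ℝ}
    (hB : 0 < B) (hgrowth : ∀ N : ℕ, L ((s ^ N * p) * (s ^ N * p)) ≤ C * B ^ (2 * N)) :
    L ((s * p) * (s * p)) ≤ B ^ 2 * L (p * p) := by
  set m : ℕ → ℝ := fun N => L ((s ^ N * p) * (s ^ N * p)) with hm
  have h0 : L (p * p) = m 0 := by simp [hm]
  have h1 : L ((s * p) * (s * p)) = m 1 := by simp [hm]
  rw [h0, h1]
  by_contra! hlt
  have hnn : ∀ N, 0 ≤ m N := fun N => hL _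
  have hcs : ∀ N, m (N + 1) ^ 2 ≤ m N * m (N + 2) := by
    intro N
    have := cauchySchwarz_of_sq_nonneg hL (s ^ N * p) (s ^ (N + 2) * p)
    rwa [show s ^ N * p * (s ^ (N + 2) * p) = (s ^ (N + 1) * p) * (s ^ (N + 1) * p) by ring] at this
  have hm1 : 0 < m 1 := lt_of_le_of_lt (mul_nonneg (sq_nonneg B) (hnn 0)) hlt
  have hm0 : 0 < m 0 := by
    refine (hnn 0).lt_of_ne fun h => ?_
    have := hcs 0
    rw [← h, zero_mul] at this
    have := pow_pos hm1 2
    simp only [zero_add] at *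
    linarith
  set r := m 1 / m 0 with hr
  have hrB : B ^ 2 < r := (lt_div_iff₀ hm0).2 hlt
  have hrpos : 0 < r := div_pos hm1 hm0
  have hstep : ∀ N, 0 < m N ∧ r * m N ≤ m (N + 1) := by
    intro N
    induction N with
    | zero => exact ⟨hm0, by rw [hr, div_mul_cancel₀ _ hm0.ne']⟩
    | succ N ih =>
      obtain ⟨hp, hle⟩ := ih
      have hp' : 0 < m (N + 1) := lt_of_lt_of_le (mul_pos hrpos hp) hle
      refine ⟨hp', ?_⟩
      have hc := hcs N
      have h2 : r * m N * m (N + 1) ≤ m N * m (N + 2) :=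
        (mul_le_mul_of_nonneg_right hle hp'.le).trans (by rw [← sq]; exact hc)
      refine le_of_mul_le_mul_left ?_ hp
      calc m N * (r * m (N + 1)) = r * m N * m (N + 1) := by ring
        _ ≤ _ := h2
  have hgeom : ∀ N, r ^ N * m 0 ≤ m N := by
    intro N
    induction N with
    | zero => simp
    | succ N ih =>
      calc r ^ (N + 1) * m 0 = r * (r ^ N * m 0) := by ring
        _ ≤ r * m N := by gcongr
        _ ≤ _ := (hstep N).2
  have hratio : 1 < r / B ^ 2 := (one_lt_div (by positivity)).2 hrB
  obtain ⟨N, hN⟩ := pow_unbounded_of_one_lt (C / m 0) hratio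
  have h2 : (r / B ^ 2) ^ N * m 0 ≤ C := by
    rw [div_pow, ← pow_mul, div_mul_eq_mul_div, div_le_iff₀ (by positivity)]
    exact (hgeom N).trans (hgrowth N)
  rw [div_lt_iff₀ hm0] at hN
  linarith

theorem nonneg_affine_mul_sq (hL : ∀ q, 0 ≤ L (q * q)) {s p : MvPolynomial σ ℝ} {B : ℝ}
    (hB : 0 < B) (h : L ((s * p) * (s * p)) ≤ B ^ 2 * L (p * p)) :
    0 ≤ L ((C B + s) * (p * p)) := by
  have h1 := hL ((C B + s) * p)
  have h2 : (C B + s) * p * ((C B + s) * p) =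
      (2 * B) • ((C B + s) * (p * p)) + (s * p) * (s * p) - (B ^ 2) • (p * p) := by
    simp only [smul_eq_C_mul, map_mul, map_ofNat, map_pow]
    ring
  rw [h2, map_sub, map_add, map_smul, map_smul, smul_eq_mul, smul_eq_mul] at h1
  have h3 : 0 ≤ (2 * B) * L ((C B + s) * (p * p)) := by linarith
  exact nonneg_of_mul_nonneg_right h3 (by positivity)

end Functional

/-! ### Infinite moment sequences -/

/-- The sequences that are feasible for the relaxations of all orders. -/
def feasibleSequences {σ : Type} (Q : Set (MvPolynomial σ ℝ × ℕ)) : Set ((σ →₀ ℕ) → ℝ) :=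
  {w | ∀ i, SatisfiesUpTo Q i w}

section Sequences

variable {σ : Type} {Q : Set (MvPolynomial σ ℝ × ℕ)}

theorem mem_feasibleSequences {w : (σ →₀ ℕ) → ℝ} :
    w ∈ feasibleSequences Q ↔
      w 0 = 1 ∧ ∀ p k, (p, k) ∈ Q → ∀ q, 0 ≤ riesz w (p * (q * q)) :=
  ⟨fun h => ⟨(h 0).mass, fun p k hp q => (h _).nonneg p k hp q le_rfl⟩,
    fun h _ => ⟨h.1, fun p k hp q _ => h.2 p k hp q⟩⟩

theorem abs_riesz_monomial_mul_le {w : (σ →₀ ℕ) → ℝ} {B : ℝ}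
    (hw : w ∈ momentBox σ B) (α : σ →₀ ℕ) (p : MvPolynomial σ ℝ) :
    |riesz w (monomial α 1 * p)| ≤
      (∑ γ ∈ p.support, |p.coeff γ| * B ^ γ.degree) * B ^ α.degree := by
  rw [mul_comm, riesz_mul_monomial_one, shift, Finset.sum_mul]
  refine (Finset.abs_sum_le_sum_abs _ _).trans (Finset.sum_le_sum fun γ _ => ?_)
  rw [abs_mul, mul_assoc, ← pow_add, add_comm γ.degree, ← map_add]
  exact mul_le_mul_of_nonneg_left (mem_momentBox.1 hw _) (abs_nonneg _)

/-- Multiplying a feasible functional by `B + a X_s`, `|a| = 1`, preserves positivity. -/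
theorem riesz_affine_mul_nonneg {w : (σ →₀ ℕ) → ℝ} {B a : ℝ} (hB : 0 < B)
    (hw : w ∈ momentBox σ B) (hwF : w ∈ feasibleSequences Q) (ha : a * a = 1) (s : σ)
    {p : MvPolynomial σ ℝ} {k : ℕ} (hp : (p, k) ∈ Q) (q : MvPolynomial σ ℝ) :
    0 ≤ riesz w ((C B + a • X s) * (p * (q * q))) := by
  set L : MvPolynomial σ ℝ →ₗ[ℝ] ℝ := riesz w ∘ₗ LinearMap.mulLeft ℝ p with hLdef
  have hL : ∀ r, 0 ≤ L (r * r) := fun r => (mem_feasibleSequences.1 hwF).2 p k hp r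
  have := nonneg_affine_mul_sq hL (s := a • X s) (p := q) hB
    (sq_mul_le_of_growth (C := ∑ γ ∈ (p * (q * q)).support,
      |(p * (q * q)).coeff γ| * B ^ γ.degree) hL hB fun N => ?_)
  · rwa [hLdef, LinearMap.comp_apply, LinearMap.mulLeft_apply, mul_left_comm] at this
  · have h := (le_abs_self _).trans
      (abs_riesz_monomial_mul_le hw (Finsupp.single s (2 * N)) (p * (q * q)))
    rw [Finsupp.degree_single] at h
    refine le_trans (le_of_eq ?_) h
    rw [hLdef, LinearMap.comp_apply, LinearMap.mulLeft_apply, ← X_pow_eq_monomial]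
    congr 1
    have hC : (C a * C a : MvPolynomial σ ℝ) = 1 := by rw [← C_mul, ha, C_1]
    have hCN : (C a ^ N * C a ^ N : MvPolynomial σ ℝ) = 1 := by rw [← mul_pow, hC, one_pow]
    rw [smul_eq_C_mul]
    calc _ = (C a ^ N * C a ^ N) * (X s ^ (2 * N) * (p * (q * q))) := by ring
      _ = _ := by rw [hCN, one_mul]

/-- The normalized sequence of the functional `p ↦ L_w((B + a X_s) p)`. -/
def tilt (w : (σ →₀ ℕ) → ℝ) (s : σ) (B a : ℝ) : (σ →₀ ℕ) → ℝ := fun γ =>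
  (B + a * w (Finsupp.single s 1))⁻¹ * riesz w ((C B + a • X s) * monomial γ 1)

theorem riesz_tilt (w : (σ →₀ ℕ) → ℝ) (s : σ) (B a : ℝ) (p : MvPolynomial σ ℝ) :
    riesz (tilt w s B a) p =
      (B + a * w (Finsupp.single s 1))⁻¹ * riesz w ((C B + a • X s) * p) := by
  have := linearMap_eq_riesz ((B + a * w (Finsupp.single s 1))⁻¹ •
    (riesz w ∘ₗ LinearMap.mulLeft ℝ (C B + a • X s)))
  exact LinearMap.congr_fun this p

theorem riesz_affine {w : (σ →₀ ℕ) → ℝ} (s : σ) (B a : ℝ) (p : MvPolynomial σ ℝ) :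
    riesz w ((C B + a • X s) * p) = B * riesz w p + a * riesz w (X s * p) := by
  rw [add_mul, map_add, C_mul', map_smul, smul_mul_assoc, map_smul, smul_eq_mul, smul_eq_mul]

theorem tilt_mem_feasibleSequences {w : (σ →₀ ℕ) → ℝ} {B a : ℝ} (hB : 0 < B)
    (hw : w ∈ momentBox σ B) (hwF : w ∈ feasibleSequences Q) (ha : a * a = 1) (s : σ)
    (hpos : 0 < B + a * w (Finsupp.single s 1)) :
    tilt w s B a ∈ feasibleSequences Q := by
  refine mem_feasibleSequences.2 ⟨?_, fun p k hp q => ?_⟩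
  · rw [← riesz_one (tilt w s B a), riesz_tilt, riesz_affine, mul_one, riesz_one, riesz_X,
      (mem_feasibleSequences.1 hwF).1, mul_one, inv_mul_cancel₀ hpos.ne']
  · rw [riesz_tilt]
    exact mul_nonneg (inv_nonneg.2 hpos.le) (riesz_affine_mul_nonneg hB hw hwF ha s hp q)

/-- Extreme feasible sequences are multiplicative. -/
theorem riesz_X_mul_of_mem_extremePoints {w : (σ →₀ ℕ) → ℝ} {B : ℝ} (hB : 1 ≤ B)
    (hw : w ∈ momentBox σ B) (hwE : w ∈ (feasibleSequences Q).extremePoints ℝ) (s : σ)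
    (p : MvPolynomial σ ℝ) :
    riesz w (X s * p) = w (Finsupp.single s 1) * riesz w p := by
  have hws : |w (Finsupp.single s 1)| ≤ B := by
    simpa using mem_momentBox.1 hw (Finsupp.single s 1)
  obtain ⟨hl, hu⟩ := abs_le.1 hws
  have hw' : w ∈ momentBox σ (B + 1) := mem_momentBox.2 fun γ =>
    (mem_momentBox.1 hw γ).trans (pow_le_pow_left₀ (by linarith) (by linarith) _)
  have h1 : 0 < B + 1 + 1 * w (Finsupp.single s 1) := by linarith
  have h2 : 0 < B + 1 + (-1) * w (Finsupp.single s 1) := by linarith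
  have hB1 : 0 < B + 1 := by linarith
  have hcancel : ∀ c x : ℝ, c ≠ 0 → c / (2 * (B + 1)) * (c⁻¹ * x) = x / (2 * (B + 1)) := by
    intro c x hc
    field_simp
  have hseg : w ∈ openSegment ℝ (tilt w s (B + 1) 1) (tilt w s (B + 1) (-1)) := by
    refine ⟨(B + 1 + 1 * w (Finsupp.single s 1)) / (2 * (B + 1)),
      (B + 1 + (-1) * w (Finsupp.single s 1)) / (2 * (B + 1)), by positivity, by positivity,
      by field_simp; ring, ?_⟩
    funext γ
    simp only [Pi.add_apply, Pi.smul_apply, smul_eq_mul, tilt, riesz_affine, riesz_monomial_one]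
    rw [hcancel _ _ h1.ne', hcancel _ _ h2.ne']
    field_simp
    ring
  have := hwE.2 (tilt_mem_feasibleSequences hB1 hw' hwE.1 (by norm_num) s h1)
    (tilt_mem_feasibleSequences hB1 hw' hwE.1 (by norm_num) s h2) hseg
  have hr := riesz_tilt w s (B + 1) 1 p
  rw [this, riesz_affine, eq_inv_mul_iff_mul_eq₀ h1.ne'] at hr
  linarith

theorem riesz_eq_eval {w : (σ →₀ ℕ) → ℝ} (h0 : w 0 = 1)
    (hmul : ∀ s p, riesz w (X s * p) = w (Finsupp.single s 1) * riesz w p)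
    (p : MvPolynomial σ ℝ) : riesz w p = eval (fun s => w (Finsupp.single s 1)) p := by
  induction p using MvPolynomial.induction_on with
  | C a => rw [C_apply, riesz_monomial, h0, mul_one, ← C_apply, eval_C]
  | add p q hp hq => rw [map_add, map_add, hp, hq]
  | mul_X p s hp => rw [mul_comm, hmul, hp, map_mul, eval_X]

variable [Fintype σ]

theorem feasibleSequences_subset_momentBox {R : ℝ} (h1 : (1, 0) ∈ Q)
    (hR : (ballPoly σ R, 1) ∈ Q) : feasibleSequences Q ⊆ momentBox σ (max 1 R) :=
  fun _ hw => mem_momentBox.2 fun γ => (hw γ.degree).abs_le h1 hR γ (by omega)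

/-- Every moment of a feasible sequence is bounded below by a value at a point of the set described
by the constraints. -/
theorem exists_eval_le_of_mem_feasibleSequences {R : ℝ} (h1 : (1, 0) ∈ Q)
    (hR : (ballPoly σ R, 1) ∈ Q) {w : (σ →₀ ℕ) → ℝ} (hw : w ∈ feasibleSequences Q) (s : σ) :
    ∃ v ∈ solutionSet Q, v s ≤ w (Finsupp.single s 1) := by
  have hsub := feasibleSequences_subset_momentBox h1 hR
  have hclosed : IsClosed (feasibleSequences Q) := by
    have : feasibleSequences Q = ⋂ i, {w | SatisfiesUpTo Q i w} := by
      ext w; simp [feasibleSequences]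
    rw [this]
    exact isClosed_iInter fun i => isClosed_setOf_satisfiesUpTo Q i
  have hcomp : IsCompact (feasibleSequences Q) := (isCompact_momentBox σ _).of_isClosed_subset
    hclosed hsub
  set l : StrongDual ℝ ((σ →₀ ℕ) → ℝ) := -ContinuousLinearMap.proj (Finsupp.single s 1) with hl
  have hexp : IsExposed ℝ (feasibleSequences Q)
      (l.toExposed (feasibleSequences Q)) := ContinuousLinearMap.toExposed.isExposed
  obtain ⟨w₀, hw₀, hmin⟩ := hcomp.exists_isMinOn ⟨w, hw⟩
    (continuous_apply (Finsupp.single s 1)).continuousOn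
  have hmem : w₀ ∈ l.toExposed (feasibleSequences Q) :=
    ⟨hw₀, fun y hy => neg_le_neg (isMinOn_iff.1 hmin y hy)⟩
  obtain ⟨e, he⟩ := (hexp.isCompact hcomp).extremePoints_nonempty ⟨w₀, hmem⟩
  have heE := hexp.isExtreme.extremePoints_subset_extremePoints he
  have hev := riesz_eq_eval (mem_feasibleSequences.1 heE.1).1
    (riesz_X_mul_of_mem_extremePoints (le_max_left 1 R) (hsub heE.1) heE)
  refine ⟨fun r => e (Finsupp.single r 1), fun p k hp => ?_, ?_⟩
  · have := (mem_feasibleSequences.1 heE.1).2 p k hp 1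
    rwa [mul_one, mul_one, hev] at this
  · exact neg_le_neg_iff.1 (he.1.2 w hw)

/-- The relaxations are eventually tight. -/
theorem exists_order_lt_of_satisfiesUpTo {R : ℝ}
    (hdeg : ∀ p k, (p, k) ∈ Q → p.totalDegree ≤ 2 * k) (h1 : (1, 0) ∈ Q)
    (hR : (ballPoly σ R, 1) ∈ Q) (s : σ) {ρ : ℝ} (hρ : ∀ v ∈ solutionSet Q, ρ < v s) :
    ∃ i, 1 ≤ i ∧ ∀ w, SatisfiesUpTo Q i w → ρ < w (Finsupp.single s 1) := by
  by_contra! h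
  set F : ℕ → Set ((σ →₀ ℕ) → ℝ) := fun i => momentBox σ (max 1 R) ∩
    ({w | SatisfiesUpTo Q (i + 1) w} ∩ {w | w (Finsupp.single s 1) ≤ ρ}) with hF
  have hcl : ∀ i, IsClosed ({w | SatisfiesUpTo Q (i + 1) w} ∩
      {w : (σ →₀ ℕ) → ℝ | w (Finsupp.single s 1) ≤ ρ}) := fun i =>
    (isClosed_setOf_satisfiesUpTo Q _).inter (isClosed_le (continuous_apply _) continuous_const)
  have hcomp : ∀ i, IsCompact (F i) := fun i => (isCompact_momentBox σ _).inter_right (hcl i)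
  obtain ⟨w, hw⟩ := IsCompact.nonempty_iInter_of_sequence_nonempty_isCompact_isClosed F
    (fun i w hw => ⟨hw.1, SatisfiesUpTo.mono hw.2.1 (Nat.le_succ _), hw.2.2⟩)
    (fun i => by
      obtain ⟨w, hw, hle⟩ := h (i + 1) (by omega)
      refine ⟨truncate (2 * (i + 1)) w, hw.truncate_mem_momentBox h1 hR, hw.truncate hdeg, ?_⟩
      rw [Set.mem_ofPred_eq, truncate_apply w (by rw [Finsupp.degree_single]; omega)]
      exact hle)
    (hcomp 0) (fun i => (hcomp i).isClosed)
  rw [Set.mem_iInter] at hw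
  obtain ⟨v, hv, hle⟩ := exists_eval_le_of_mem_feasibleSequences h1 hR (w := w)
    (fun i => SatisfiesUpTo.mono (hw i).2.1 (Nat.le_succ _)) s
  exact absurd (hle.trans (hw 0).2.2) (not_le.2 (hρ v hv))

end Sequences

/-! ### Flat extensions -/

section Flat

variable {σ : Type} {E : Type*} [NormedAddCommGroup E] [InnerProductSpace ℝ E]

theorem totalDegree_X_mul_le (s : σ) (p : MvPolynomial σ ℝ) :
    (X s * p).totalDegree ≤ p.totalDegree + 1 := by
  have := totalDegree_mul (X s) p
  rw [totalDegree_X] at this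
  omega

/-- In a flat Gram representation `Φ` of a functional, the multiplications by the variables descend
to commuting symmetric operators. -/
theorem exists_multiplication_operators {L : MvPolynomial σ ℝ →ₗ[ℝ] ℝ}
    {Φ : MvPolynomial σ ℝ →ₗ[ℝ] E} {i : ℕ}
    (hinner : ∀ p q : MvPolynomial σ ℝ, p.totalDegree ≤ i → q.totalDegree ≤ i →
      inner ℝ (Φ p) (Φ q) = L (p * q))
    (hsurj : ∀ e, ∃ p : MvPolynomial σ ℝ, p.totalDegree + 1 ≤ i ∧ Φ p = e) :
    ∃ T : σ → E →ₗ[ℝ] E, (∀ s, (T s).IsSymmetric) ∧ (∀ s r, Commute (T s) (T r)) ∧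
      ∀ s p, p.totalDegree + 1 ≤ i → T s (Φ p) = Φ (X s * p) := by
  choose r hrdeg hr using hsurj
  have hX : ∀ s {p : MvPolynomial σ ℝ}, p.totalDegree + 1 ≤ i → (X s * p).totalDegree ≤ i :=
    fun s p hp => (totalDegree_X_mul_le s p).trans hp
  have hker : ∀ s (p : MvPolynomial σ ℝ), p.totalDegree + 1 ≤ i → Φ p = 0 → Φ (X s * p) = 0 := by
    intro s p hp h0
    rw [← inner_self_eq_zero (𝕜 := ℝ)]
    nth_rewrite 2 [← hr (Φ (X s * p))]
    rw [hinner _ _ (hX s hp) (by have := hrdeg (Φ (X s * p)); omega), mul_right_comm, mul_comm,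
      ← hinner p _ (by omega) (hX s (hrdeg _)), h0, inner_zero_left]
  have hwd : ∀ s (p q : MvPolynomial σ ℝ), p.totalDegree + 1 ≤ i → q.totalDegree + 1 ≤ i →
      Φ p = Φ q → Φ (X s * p) = Φ (X s * q) := by
    intro s p q hp hq h
    have hpq : (p - q).totalDegree + 1 ≤ i := by
      have := totalDegree_sub p q
      omega
    have := hker s (p - q) hpq (by rw [map_sub, h, sub_self])
    rwa [mul_sub, map_sub, sub_eq_zero] at this
  let T : σ → E →ₗ[ℝ] E := fun s =>
    { toFun := fun e => Φ (X s * r e)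
      map_add' := fun a b => by
        rw [← map_add, ← mul_add]
        refine hwd s _ _ (hrdeg _) ?_ (by rw [map_add, hr, hr, hr])
        have := totalDegree_add (r a) (r b)
        have := hrdeg a
        have := hrdeg b
        omega
      map_smul' := fun c a => by
        rw [RingHom.id_apply, ← map_smul, ← mul_smul_comm]
        refine hwd s _ _ (hrdeg _) ?_ (by rw [map_smul, hr, hr])
        have := totalDegree_smul_le c (r a)
        have := hrdeg a
        omega }
  have hT : ∀ s p, p.totalDegree + 1 ≤ i → T s (Φ p) = Φ (X s * p) :=
    fun s p hp => hwd s _ _ (hrdeg _) hp (hr _)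
  have hsymm : ∀ s, (T s).IsSymmetric := by
    intro s a b
    have ha := hrdeg a
    have hb := hrdeg b
    rw [← hr a, ← hr b, hT s _ ha, hT s _ hb, hinner _ _ (hX s ha) (by omega),
      hinner _ _ (by omega) (hX s hb)]
    congr 1
    ring
  refine ⟨T, hsymm, fun s t => LinearMap.ext fun a => ext_inner_right ℝ fun b => ?_, hT⟩
  have ha := hrdeg a
  have hb := hrdeg b
  rw [Module.End.mul_apply, Module.End.mul_apply, hsymm s (T t a) b, hsymm t (T s a) b, ← hr a, ← hr b, hT s _ ha,
    hT s _ hb, hT t _ ha, hT t _ hb, hinner _ _ (hX t ha) (hX s hb),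
    hinner _ _ (hX s ha) (hX t hb)]
  congr 1
  ring

/-- A functional with a flat Gram representation is a combination of as many point evaluations as
the dimension of the representation. -/
theorem exists_atoms_of_flat [FiniteDimensional ℝ E] [Finite σ] {L : MvPolynomial σ ℝ →ₗ[ℝ] ℝ}
    {Φ : MvPolynomial σ ℝ →ₗ[ℝ] E} {i k : ℕ} (hki : k + 1 ≤ i)
    (hinner : ∀ p q : MvPolynomial σ ℝ, p.totalDegree ≤ i → q.totalDegree ≤ i →
      inner ℝ (Φ p) (Φ q) = L (p * q))
    (hsurj : ∀ e, ∃ p : MvPolynomial σ ℝ, p.totalDegree ≤ k ∧ Φ p = e) :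
    ∃ (T : Finset (σ → ℝ)) (m : (σ → ℝ) → ℝ), T.card = Module.finrank ℝ E ∧
      (∀ v ∈ T, 0 < m v) ∧
      (∀ p : MvPolynomial σ ℝ, p.totalDegree ≤ 2 * i → L p = ∑ v ∈ T, m v * eval v p) ∧
      ∀ v ∈ T, ∃ q : MvPolynomial σ ℝ, q.totalDegree ≤ k ∧ eval v q = 1 ∧
        ∀ v' ∈ T, v' ≠ v → eval v' q = 0 := by
  obtain ⟨T, hsymm, hcomm, hT⟩ := exists_multiplication_operators hinner fun e => by
    obtain ⟨p, hp, he⟩ := hsurj e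
    exact ⟨p, by omega, he⟩
  have htop := LinearMap.IsSymmetric.iSup_iInf_eq_top_of_commute hsymm
    (fun s r _ => hcomm s r)
  obtain ⟨f, hf, hsum⟩ := (Submodule.mem_iSup_iff_exists_finsupp _ (Φ 1)).1
    (htop ▸ Submodule.mem_top)
  have heig : ∀ v s, T s (f v) = v s • f v := fun v s =>
    Module.End.mem_eigenspace_iff.1 ((Submodule.mem_iInf _).1 (hf v) s)
  have horth : ∀ v v', v ≠ v' → inner ℝ (f v) (f v') = 0 := fun v v' h =>
    LinearMap.IsSymmetric.orthogonalFamily_iInf_eigenspaces hsymm h ⟨f v, hf v⟩ ⟨f v', hf v'⟩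
  have hmono : ∀ γ : σ →₀ ℕ, γ.degree ≤ i →
      Φ (monomial γ 1) = ∑ v ∈ f.support, eval v (monomial γ 1) • f v := by
    intro γ
    induction γ using finsupp_induction_add_single with
    | zero =>
      intro _
      rw [← C_apply, C_1, ← hsum, Finsupp.sum]
      simp
    | add γ s ih =>
      intro hγ
      rw [map_add, Finsupp.degree_single] at hγ
      have hXm : (monomial (γ + Finsupp.single s 1) 1 : MvPolynomial σ ℝ) =
          X s * monomial γ 1 := by
        rw [X, monomial_mul, mul_one, add_comm]
      rw [hXm, ← hT s _ ((Nat.add_le_add_right (totalDegree_monomial_le_degree γ 1) 1).trans hγ),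
        ih (by omega), map_sum]
      refine Finset.sum_congr rfl fun v _ => ?_
      rw [map_smul, heig, smul_smul, map_mul, eval_X, mul_comm]
  let A : MvPolynomial σ ℝ →ₗ[ℝ] E :=
    ∑ v ∈ f.support, ((aeval v).toLinearMap : MvPolynomial σ ℝ →ₗ[ℝ] ℝ).smulRight (f v)
  have hA : ∀ p, A p = ∑ v ∈ f.support, eval v p • f v := fun p => by
    simp [A, LinearMap.sum_apply, aeval_eq_eval]
  have hΦ : ∀ p : MvPolynomial σ ℝ, p.totalDegree ≤ i →
      Φ p = ∑ v ∈ f.support, eval v p • f v := fun p hp => by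
    rw [← hA]
    exact linearMap_eq_of_totalDegree_le (fun γ hγ => by rw [hA, hmono γ hγ]) hp
  have hnorm : ∀ v ∈ f.support, 0 < ‖f v‖ ^ 2 := fun v hv =>
    pow_pos (norm_pos_iff.2 (Finsupp.mem_support_iff.1 hv)) 2
  have hcoef : ∀ v ∈ f.support, ∀ c : (σ → ℝ) → ℝ,
      inner ℝ (∑ v' ∈ f.support, c v' • f v') (f v) = c v * ‖f v‖ ^ 2 := by
    intro v hv c
    rw [sum_inner, Finset.sum_eq_single v]
    · rw [real_inner_smul_left, real_inner_self_eq_norm_sq]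
    · intro v' _ hne
      rw [real_inner_smul_left, horth v' v hne, mul_zero]
    · exact fun h => absurd hv h
  refine ⟨f.support, fun v => ‖f v‖ ^ 2, ?_, hnorm, ?_, ?_⟩
  · have hli : LinearIndependent ℝ (fun v : f.support => f v) :=
      linearIndependent_of_ne_zero_of_inner_eq_zero (𝕜 := ℝ)
        (fun v => Finsupp.mem_support_iff.1 v.2) (fun v v' h => horth _ _ (Subtype.coe_ne_coe.2 h))
    have hspan : ⊤ ≤ Submodule.span ℝ (Set.range fun v : f.support => f v) := by
      intro e _
      obtain ⟨p, hp, rfl⟩ := hsurj e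
      rw [hΦ p (by omega)]
      exact Submodule.sum_mem _ fun v hv =>
        Submodule.smul_mem _ _ (Submodule.subset_span ⟨⟨v, hv⟩, rfl⟩)
    rw [Module.finrank_eq_card_basis (Module.Basis.mk hli hspan), Fintype.card_coe]
  · let B : MvPolynomial σ ℝ →ₗ[ℝ] ℝ :=
      ∑ v ∈ f.support, ‖f v‖ ^ 2 • (aeval v).toLinearMap
    have hB : ∀ p, B p = ∑ v ∈ f.support, ‖f v‖ ^ 2 * eval v p := fun p => by
      simp [B, LinearMap.sum_apply, aeval_eq_eval]
    intro p hp
    rw [← hB]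
    refine linearMap_eq_of_totalDegree_le (fun γ hγ => ?_) hp
    obtain ⟨α, β, rfl, hα, hβ⟩ := exists_add_eq_of_degree_le (hγ.trans_eq (two_mul i))
    have hα' := (totalDegree_monomial_le_degree α (1 : ℝ)).trans hα
    have hβ' := (totalDegree_monomial_le_degree β (1 : ℝ)).trans hβ
    have hmul : (monomial (α + β) 1 : MvPolynomial σ ℝ) = monomial α 1 * monomial β 1 := by
      rw [monomial_mul, mul_one]
    rw [hB, hmul, ← hinner _ _ hα' hβ', hΦ _ hα', hΦ _ hβ', inner_sum]
    refine Finset.sum_congr rfl fun v hv => ?_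
    rw [real_inner_smul_right, hcoef v hv, map_mul]
    ring
  · intro v hv
    obtain ⟨q, hq, he⟩ := hsurj (f v)
    rw [hΦ q (by omega)] at he
    refine ⟨q, hq, ?_, fun v' hv' hne => ?_⟩
    · have h := hcoef v hv fun v' => eval v' q
      rw [he, real_inner_self_eq_norm_sq] at h
      exact mul_right_cancel₀ (hnorm v hv).ne' (by rw [← h, one_mul])
    · have h := hcoef v' hv' fun v' => eval v' q
      rw [he, horth v v' hne.symm] at h
      exact (mul_eq_zero.1 h.symm).resolve_right (hnorm v' hv').ne'

end Flat

section Gram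

variable {σ : Type} [Finite σ]

/-- A positive semidefinite moment matrix is the Gram matrix of the images of the monomials. -/
theorem exists_gram_of_posSemidef {i : ℕ} {w : (σ →₀ ℕ) → ℝ}
    (h : (momentMatrix i w).PosSemidef) :
    ∃ Φ : MvPolynomial σ ℝ →ₗ[ℝ] EuclideanSpace ℝ (MonoLE σ i),
      (∀ p q : MvPolynomial σ ℝ, p.totalDegree ≤ i → q.totalDegree ≤ i →
        inner ℝ (Φ p) (Φ q) = riesz w (p * q)) ∧
      ∀ γ : σ →₀ ℕ, i < γ.degree → Φ (monomial γ 1) = 0 := by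
  classical
  obtain ⟨B, hB⟩ : ∃ B : Matrix (MonoLE σ i) (MonoLE σ i) ℝ,
      momentMatrix i w = B.conjTranspose * B := by
    open scoped MatrixOrder in
    exact CStarAlgebra.nonneg_iff_eq_star_mul_self.1 (Matrix.nonneg_iff_posSemidef.2 h)
  set b : MonoLE σ i → EuclideanSpace ℝ (MonoLE σ i) := fun α => WithLp.toLp 2 (B.col α) with hb
  have hbb : ∀ α β, inner ℝ (b α) (b β) = w (α.1 + β.1) := by
    intro α β
    have := congrFun (congrFun hB α) β
    rw [momentMatrix, Matrix.of_apply] at this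
    rw [this, Matrix.mul_apply, hb, PiLp.inner_apply]
    refine Finset.sum_congr rfl fun r _ => ?_
    simp [mul_comm]
  set Φ : MvPolynomial σ ℝ →ₗ[ℝ] EuclideanSpace ℝ (MonoLE σ i) :=
    (basisMonomials σ ℝ).constr ℝ fun γ => if hγ : γ.degree ≤ i then b ⟨γ, hγ⟩ else 0 with hΦ
  have hΦm : ∀ γ, Φ (monomial γ 1) = if hγ : γ.degree ≤ i then b ⟨γ, hγ⟩ else 0 := by
    intro γ
    rw [hΦ, ← (basisMonomials σ ℝ).constr_basis ℝ (fun γ : σ →₀ ℕ =>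
      if hγ : γ.degree ≤ i then b ⟨γ, hγ⟩ else 0) γ, coe_basisMonomials]
  refine ⟨Φ, fun p q hp hq => ?_, fun γ hγ => by rw [hΦm, dif_neg hγ.not_ge]⟩
  have h1 : ∀ α : σ →₀ ℕ, α.degree ≤ i → inner ℝ (Φ (monomial α 1)) (Φ q) =
      riesz w (monomial α 1 * q) := by
    intro α hα
    refine linearMap_eq_of_totalDegree_le
      (A := (innerₗ (EuclideanSpace ℝ (MonoLE σ i)) (Φ (monomial α 1))) ∘ₗ Φ)
      (B := riesz w ∘ₗ LinearMap.mulLeft ℝ (monomial α 1)) (fun β hβ => ?_) hq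
    rw [LinearMap.comp_apply, LinearMap.comp_apply, LinearMap.mulLeft_apply, innerₗ_apply_apply,
      hΦm, hΦm, dif_pos hα, dif_pos hβ, hbb, monomial_mul, mul_one, riesz_monomial_one]
  have h2 := linearMap_eq_of_totalDegree_le
    (A := (innerₗ (EuclideanSpace ℝ (MonoLE σ i)) (Φ q)) ∘ₗ Φ)
    (B := riesz w ∘ₗ LinearMap.mulRight ℝ q) (fun β hβ => by
      rw [LinearMap.comp_apply, LinearMap.comp_apply, LinearMap.mulRight_apply, innerₗ_apply_apply,
        real_inner_comm, h1 β hβ]) hp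
  rwa [LinearMap.comp_apply, innerₗ_apply_apply, real_inner_comm] at h2

theorem rank_momentMatrix_eq_finrank_span {ι : Type*} [Fintype ι] {i k : ℕ} (hki : k ≤ i)
    {w : (σ →₀ ℕ) → ℝ} {Φ : MvPolynomial σ ℝ →ₗ[ℝ] EuclideanSpace ℝ ι}
    (hΦ : ∀ p q : MvPolynomial σ ℝ, p.totalDegree ≤ i → q.totalDegree ≤ i →
      inner ℝ (Φ p) (Φ q) = riesz w (p * q)) :
    (momentMatrix k w).rank = Module.finrank ℝ
      (Submodule.span ℝ (Set.range fun α : MonoLE σ k => Φ (monomial α.1 1))) := by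
  set A : Matrix ι (MonoLE σ k) ℝ := Matrix.of fun r α => Φ (monomial α.1 1) r with hA
  have hM : momentMatrix k w = A.conjTranspose * A := by
    ext α β
    have h := hΦ (monomial α.1 1) (monomial β.1 1)
      ((totalDegree_monomial_le_degree _ _).trans (α.2.trans hki))
      ((totalDegree_monomial_le_degree _ _).trans (β.2.trans hki))
    rw [monomial_mul, mul_one, riesz_monomial_one, PiLp.inner_apply] at h
    rw [momentMatrix, Matrix.of_apply, ← h, Matrix.mul_apply]
    refine Finset.sum_congr rfl fun r _ => ?_
    simp [hA, mul_comm]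
  rw [hM, Matrix.rank_conjTranspose_mul_self, Matrix.rank_eq_finrank_span_cols,
    ← LinearEquiv.finrank_map_eq (WithLp.linearEquiv 2 ℝ (ι → ℝ)), Submodule.map_span,
    ← Set.range_comp]
  rfl

theorem exists_atoms_of_finrank_span_eq {E : Type*} [NormedAddCommGroup E]
    [InnerProductSpace ℝ E] [FiniteDimensional ℝ E] {i k d : ℕ} (hki : k + 1 ≤ i)
    {L : MvPolynomial σ ℝ →ₗ[ℝ] ℝ} {Φ : MvPolynomial σ ℝ →ₗ[ℝ] E}
    (hΦ : ∀ p q : MvPolynomial σ ℝ, p.totalDegree ≤ i → q.totalDegree ≤ i →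
      inner ℝ (Φ p) (Φ q) = L (p * q))
    (hΦ0 : ∀ γ : σ →₀ ℕ, i < γ.degree → Φ (monomial γ 1) = 0)
    {V W : Submodule ℝ E}
    (hV : V = Submodule.span ℝ (Set.range fun α : MonoLE σ i => Φ (monomial α.1 1)))
    (hW : W = Submodule.span ℝ (Set.range fun α : MonoLE σ k => Φ (monomial α.1 1)))
    (hVd : Module.finrank ℝ V = d) (hWd : Module.finrank ℝ W = d) :
    ∃ (T : Finset (σ → ℝ)) (m : (σ → ℝ) → ℝ), T.card = d ∧
      (∀ v ∈ T, 0 < m v) ∧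
      (∀ p : MvPolynomial σ ℝ, p.totalDegree ≤ 2 * i → L p = ∑ v ∈ T, m v * eval v p) ∧
      ∀ v ∈ T, ∃ q : MvPolynomial σ ℝ, q.totalDegree ≤ k ∧ eval v q = 1 ∧
        ∀ v' ∈ T, v' ≠ v → eval v' q = 0 := by
  have hle : W ≤ V := by
    rw [hV, hW]
    refine Submodule.span_mono ?_
    rintro _ ⟨α, rfl⟩
    exact ⟨⟨α.1, α.2.trans (by omega)⟩, rfl⟩
  have hEq : W = V := Submodule.eq_of_le_of_finrank_eq hle (hWd.trans hVd.symm)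
  have hmem : ∀ p, Φ p ∈ V := by
    intro p
    rw [p.as_sum, map_sum]
    refine Submodule.sum_mem _ fun γ _ => ?_
    rw [monomial_eq_smul_one, map_smul]
    refine Submodule.smul_mem _ _ ?_
    by_cases hγ : γ.degree ≤ i
    · rw [hV]
      exact Submodule.subset_span ⟨⟨γ, hγ⟩, rfl⟩
    · rw [hΦ0 γ (not_le.1 hγ)]
      exact Submodule.zero_mem _
  have hsurj : ∀ e : V, ∃ p : MvPolynomial σ ℝ,
      p.totalDegree ≤ k ∧ Φ.codRestrict V hmem p = e := by
    intro e
    have he : e.1 ∈ Submodule.span ℝ (Set.range fun α : MonoLE σ k => Φ (monomial α.1 1)) := by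
      rw [← hW, hEq]
      exact e.2
    obtain ⟨x, hx⟩ := (Submodule.mem_span_range_iff_exists_fun ℝ).1 he
    refine ⟨_, totalDegree_sum_monoLE x, Subtype.ext ?_⟩
    rw [LinearMap.codRestrict_apply, map_sum, ← hx]
    refine Finset.sum_congr rfl fun α _ => ?_
    rw [monomial_eq_smul_one, map_smul]
  subst hVd
  exact exists_atoms_of_flat (Φ := Φ.codRestrict V hmem) hki
    (fun p q hp hq => (Submodule.coe_inner _ _ _).trans (hΦ p q hp hq)) hsurj

/-- The flat extension theorem: if the moment matrix of order `i` has the rank `d` of one of lower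
order, the moments of degree at most `2i` are those of a measure with `d` atoms. -/
theorem exists_atoms_of_rank_eq {i k d : ℕ} (hki : k + 1 ≤ i) {w : (σ →₀ ℕ) → ℝ}
    (h : (momentMatrix i w).PosSemidef) (hi : (momentMatrix i w).rank = d)
    (hk : (momentMatrix k w).rank = d) :
    ∃ (T : Finset (σ → ℝ)) (m : (σ → ℝ) → ℝ), T.card = d ∧
      (∀ v ∈ T, 0 < m v) ∧
      (∀ p : MvPolynomial σ ℝ, p.totalDegree ≤ 2 * i → riesz w p = ∑ v ∈ T, m v * eval v p) ∧
      ∀ v ∈ T, ∃ q : MvPolynomial σ ℝ, q.totalDegree ≤ k ∧ eval v q = 1 ∧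
        ∀ v' ∈ T, v' ≠ v → eval v' q = 0 := by
  obtain ⟨Φ, hΦ, hΦ0⟩ := exists_gram_of_posSemidef h
  exact exists_atoms_of_finrank_span_eq hki hΦ hΦ0 rfl rfl
    ((rank_momentMatrix_eq_finrank_span le_rfl hΦ).symm.trans hi)
    ((rank_momentMatrix_eq_finrank_span (by omega) hΦ).symm.trans hk)

end Gram

section Atoms

variable {σ : Type} {Q : Set (MvPolynomial σ ℝ × ℕ)}

/-- The flat extension theorem with constraints: the atoms satisfy the constraints. -/
theorem exists_atoms_mem_solutionSet [Finite σ] {i c d : ℕ} (hc : 1 ≤ c) (hci : c ≤ i)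
    (hdeg : ∀ p k, (p, k) ∈ Q → p.totalDegree ≤ 2 * k ∧ k ≤ c) (h1 : (1, 0) ∈ Q)
    {w : (σ →₀ ℕ) → ℝ} (hw : SatisfiesUpTo Q i w)
    (hi : (momentMatrix i w).rank = d) (hk : (momentMatrix (i - c) w).rank = d) :
    ∃ (T : Finset (σ → ℝ)) (m : (σ → ℝ) → ℝ), T.card = d ∧ (∀ v ∈ T, 0 < m v) ∧
      ∑ v ∈ T, m v = 1 ∧ (T : Set (σ → ℝ)) ⊆ solutionSet Q ∧
      ∀ p : MvPolynomial σ ℝ, p.totalDegree ≤ 2 * i → riesz w p = ∑ v ∈ T, m v * eval v p := by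
  have hpsd : (momentMatrix i w).PosSemidef := by
    have := (momentMatrix_shift_posSemidef_iff (k := i) (w := w) (p := 1)).2 fun q hq =>
      hw.nonneg 1 0 h1 q hq
    rwa [shift_one] at this
  obtain ⟨T, m, hcard, hpos, hL, hint⟩ := exists_atoms_of_rank_eq (by omega) hpsd hi hk
  refine ⟨T, m, hcard, hpos, ?_, fun v hv p k hp => ?_, hL⟩
  · have := hL 1 (by simp)
    rw [riesz_one, hw.mass] at this
    simpa using this.symm
  · obtain ⟨q, hq, hone, hzero⟩ := hint v hv
    obtain ⟨hp2, hkc⟩ := hdeg p k hp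
    have hqk : q.totalDegree + k ≤ i := by omega
    have hnn := hw.nonneg p k hp q hqk
    rw [hL _ (totalDegree_mul_mul_self_le hp2 hqk),
      Finset.sum_eq_single_of_mem v hv fun v' hv' hne => by
        rw [map_mul, map_mul, hzero v' hv' hne, mul_zero, mul_zero, mul_zero],
      map_mul, map_mul, hone, mul_one, mul_one] at hnn
    exact nonneg_of_mul_nonneg_right hnn (hpos v hv)

theorem exists_isAtomicProbability [Fintype σ] {T : Finset (σ → ℝ)} {m : (σ → ℝ) → ℝ}
    {A : Set (σ → ℝ)} (hpos : ∀ v ∈ T, 0 < m v) (hsum : ∑ v ∈ T, m v = 1)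
    (hA : (T : Set (σ → ℝ)) ⊆ A) :
    ∃ μ : Measure (σ → ℝ), IsAtomicProbability μ T.card A ∧
      ∀ φ : (σ → ℝ) → ℝ, ∫ v, φ v ∂μ = ∑ v ∈ T, m v * φ v := by
  classical
  set μ : Measure (σ → ℝ) := ∑ v ∈ T, ENNReal.ofReal (m v) • Measure.dirac v with hμ
  have hap : ∀ B, MeasurableSet B →
      μ B = ∑ v ∈ T, ENNReal.ofReal (m v) * B.indicator 1 v := by
    intro B hB
    rw [hμ, Measure.finsetSum_apply]
    refine Finset.sum_congr rfl fun v _ => ?_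
    rw [Measure.smul_apply, Measure.dirac_apply' _ hB, smul_eq_mul]
  refine ⟨μ, ⟨⟨?_⟩, T, rfl, hA, fun v hv => ?_, ?_⟩, fun φ => ?_⟩
  · rw [hap _ MeasurableSet.univ]
    simp only [Set.indicator_univ, Pi.one_apply, mul_one]
    rw [← ENNReal.ofReal_sum_of_nonneg fun v hv => (hpos v hv).le, hsum, ENNReal.ofReal_one]
  · rw [hap _ (measurableSet_singleton v)]
    refine lt_of_lt_of_le (ENNReal.ofReal_pos.2 (hpos v hv)) ?_
    refine le_trans (le_of_eq ?_) (Finset.single_le_sum (fun _ _ => zero_le) hv)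
    simp
  · rw [hap _ T.measurableSet.compl]
    refine Finset.sum_eq_zero fun v hv => ?_
    rw [Set.indicator_of_notMem (by simpa using hv), mul_zero]
  · rw [hμ, integral_finsetSum_measure fun v _ => (integrable_dirac (by simp)).smul_measure
      ENNReal.ofReal_ne_top]
    refine Finset.sum_congr rfl fun v hv => ?_
    rw [integral_smul_measure, integral_dirac, ENNReal.toReal_ofReal (hpos v hv).le, smul_eq_mul]

end Atoms

namespace LiftedData

variable {n t m a r b : ℕ} (D : LiftedData n t m a r b)

/-- The constraint polynomials of the relaxations, each with the order it costs. -/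
inductive IsConstraint : MvPolynomial (Var n t m) ℝ → ℕ → Prop
  | one : IsConstraint 1 0
  | theta : IsConstraint D.theta 1
  | g (j : Fin a) : IsConstraint (D.gLift j) (halfDeg (D.g j))
  | u (k : Fin r) : IsConstraint (D.uLift k) (halfDeg (D.u k))
  | neg_u (k : Fin r) : IsConstraint (-D.uLift k) (halfDeg (D.u k))
  | q (l : Fin b) : IsConstraint (D.qLift l) (halfDeg (D.q l))
  | neg_q (l : Fin b) : IsConstraint (-D.qLift l) (halfDeg (D.q l))
  | y (j : Fin t) : j ∈ D.J → IsConstraint (X (yVar n m j)) 1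
  | z (j : Fin (m + 1)) : j ∈ D.Jf → IsConstraint (X (zVar n t j)) 1

/-- The set of constraints of the relaxations. -/
def constraints : Set (MvPolynomial (Var n t m) ℝ × ℕ) := {c | D.IsConstraint c.1 c.2}

theorem one_le_c : 1 ≤ D.c := le_max_left _ _

theorem halfDeg_g_le (j : Fin a) : halfDeg (D.g j) ≤ D.c :=
  (Finset.le_sup (f := fun j => halfDeg (D.g j)) (Finset.mem_univ j)).trans
    ((le_max_left _ _).trans (le_max_right _ _))

theorem halfDeg_u_le (k : Fin r) : halfDeg (D.u k) ≤ D.c :=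
  (Finset.le_sup (f := fun k => halfDeg (D.u k)) (Finset.mem_univ k)).trans
    ((le_max_left _ _).trans ((le_max_right _ _).trans (le_max_right _ _)))

theorem halfDeg_q_le (l : Fin b) : halfDeg (D.q l) ≤ D.c :=
  (Finset.le_sup (f := fun l => halfDeg (D.q l)) (Finset.mem_univ l)).trans
    ((le_max_right _ _).trans ((le_max_right _ _).trans (le_max_right _ _)))

theorem totalDegree_rename_le_two_mul_halfDeg {σ τ : Type} (φ : σ → τ) (p : MvPolynomial σ ℝ) :
    (rename φ p).totalDegree ≤ 2 * halfDeg p :=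
  (totalDegree_rename_le φ p).trans (by rw [halfDeg]; omega)

theorem totalDegree_theta_le : D.theta.totalDegree ≤ 2 := by
  refine (totalDegree_sub _ _).trans (max_le (by rw [totalDegree_C]; omega) ?_)
  exact totalDegree_finsetSum_le fun s _ => (totalDegree_X_pow s 2).le

theorem totalDegree_constraint_le {p : MvPolynomial (Var n t m) ℝ} {k : ℕ}
    (h : (p, k) ∈ D.constraints) : p.totalDegree ≤ 2 * k ∧ k ≤ D.c := by
  change D.IsConstraint p k at h
  have hX : ∀ s : Var n t m, (X s : MvPolynomial (Var n t m) ℝ).totalDegree ≤ 2 * 1 := fun s => by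
    rw [totalDegree_X]; omega
  cases h with
  | one => simp
  | theta => exact ⟨D.totalDegree_theta_le, D.one_le_c⟩
  | g j => exact ⟨totalDegree_rename_le_two_mul_halfDeg _ _, D.halfDeg_g_le j⟩
  | u k => exact ⟨totalDegree_rename_le_two_mul_halfDeg _ _, D.halfDeg_u_le k⟩
  | neg_u k =>
    exact ⟨(totalDegree_neg _).trans_le (totalDegree_rename_le_two_mul_halfDeg _ _),
      D.halfDeg_u_le k⟩
  | q l => exact ⟨totalDegree_rename_le_two_mul_halfDeg _ _, D.halfDeg_q_le l⟩
  | neg_q l =>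
    exact ⟨(totalDegree_neg _).trans_le (totalDegree_rename_le_two_mul_halfDeg _ _),
      D.halfDeg_q_le l⟩
  | y j hj => exact ⟨hX _, D.one_le_c⟩
  | z j hj => exact ⟨hX _, D.one_le_c⟩

theorem satisfiesUpTo_constraints_iff {i : ℕ} {w : (Var n t m →₀ ℕ) → ℝ} :
    SatisfiesUpTo D.constraints i w ↔ w 0 = 1 ∧ ∀ p k, D.IsConstraint p k →
      ∀ q : MvPolynomial (Var n t m) ℝ, q.totalDegree + k ≤ i → 0 ≤ riesz w (p * (q * q)) :=
  ⟨fun h => ⟨h.1, h.2⟩, fun h => ⟨h.1, h.2⟩⟩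

theorem feasible_iff_satisfiesUpTo {i : ℕ} (hi : D.c ≤ i) {w : (Var n t m →₀ ℕ) → ℝ} :
    D.Feasible i w ↔ SatisfiesUpTo D.constraints i w := by
  have key : ∀ (p : MvPolynomial (Var n t m) ℝ) (k : ℕ), k ≤ D.c →
      ((momentMatrix (i - k) (shift p w)).PosSemidef ↔
        ∀ q : MvPolynomial (Var n t m) ℝ, q.totalDegree + k ≤ i → 0 ≤ riesz w (p * (q * q))) := by
    intro p k hk
    rw [momentMatrix_shift_posSemidef_iff]
    exact forall_congr' fun q => imp_congr_left (Nat.le_sub_iff_add_le (hk.trans hi))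
  rw [satisfiesUpTo_constraints_iff]
  have hone := key 1 0 (Nat.zero_le _)
  rw [shift_one, Nat.sub_zero] at hone
  constructor
  · intro h
    refine ⟨h.mass, fun p k hpk => ?_⟩
    cases hpk with
    | one => exact hone.1 h.moment
    | theta => exact (key _ _ D.one_le_c).1 h.loc_theta
    | g j => exact (key _ _ (D.halfDeg_g_le j)).1 (h.loc_g j)
    | u k =>
      exact (key _ _ (D.halfDeg_u_le k)).1 (momentMatrix_shift_eq_zero_iff.1 (h.loc_u k)).1
    | neg_u k =>
      exact (key _ _ (D.halfDeg_u_le k)).1 (momentMatrix_shift_eq_zero_iff.1 (h.loc_u k)).2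
    | q l =>
      exact (key _ _ (D.halfDeg_q_le l)).1 (momentMatrix_shift_eq_zero_iff.1 (h.loc_q l)).1
    | neg_q l =>
      exact (key _ _ (D.halfDeg_q_le l)).1 (momentMatrix_shift_eq_zero_iff.1 (h.loc_q l)).2
    | y j hj => exact (key _ _ D.one_le_c).1 (h.loc_y j hj)
    | z j hj => exact (key _ _ D.one_le_c).1 (h.loc_z j hj)
  · rintro ⟨h0, h⟩
    exact
      { moment := hone.2 (h _ _ .one)
        loc_g := fun j => (key _ _ (D.halfDeg_g_le j)).2 (h _ _ (.g j))
        loc_u := fun k => momentMatrix_shift_eq_zero_iff.2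
          ⟨(key _ _ (D.halfDeg_u_le k)).2 (h _ _ (.u k)),
            (key _ _ (D.halfDeg_u_le k)).2 (h _ _ (.neg_u k))⟩
        loc_q := fun l => momentMatrix_shift_eq_zero_iff.2
          ⟨(key _ _ (D.halfDeg_q_le l)).2 (h _ _ (.q l)),
            (key _ _ (D.halfDeg_q_le l)).2 (h _ _ (.neg_q l))⟩
        loc_y := fun j hj => (key _ _ D.one_le_c).2 (h _ _ (.y j hj))
        loc_z := fun j hj => (key _ _ D.one_le_c).2 (h _ _ (.z j hj))
        loc_theta := (key _ _ D.one_le_c).2 (h _ _ .theta)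
        mass := h0 }

theorem eval_theta (v : Var n t m → ℝ) : eval v D.theta = D.M - ∑ s, v s ^ 2 := by
  simp [theta]

theorem solutionSet_constraints (hM : ∀ v ∈ D.Omega, ∑ k, v k ^ 2 < D.M) :
    solutionSet D.constraints = D.Omega := by
  ext v
  constructor
  · intro h
    have h' : ∀ p k, D.IsConstraint p k → 0 ≤ eval v p := h
    refine ⟨fun j => h' _ _ (.g j), fun k => ?_, fun l => ?_, fun j hj => ?_, fun j hj => ?_⟩
    · have := h' _ _ (.neg_u k)
      rw [map_neg] at this
      exact le_antisymm (neg_nonneg.1 this) (h' _ _ (.u k))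
    · have := h' _ _ (.neg_q l)
      rw [map_neg] at this
      exact le_antisymm (neg_nonneg.1 this) (h' _ _ (.q l))
    · simpa using h' _ _ (.y j hj)
    · simpa using h' _ _ (.z j hj)
  · intro hv p k hpk
    obtain ⟨hg, hu, hq, hy, hz⟩ := id hv
    change D.IsConstraint p k at hpk
    cases hpk with
    | one => simp
    | theta => rw [eval_theta]; exact sub_nonneg.2 (hM v hv).le
    | g j => exact hg j
    | u k => exact (hu k).ge
    | neg_u k => rw [map_neg, hu k, neg_zero]
    | q l => exact (hq l).ge
    | neg_q l => rw [map_neg, hq l, neg_zero]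
    | y j hj => rw [eval_X]; exact hy j hj
    | z j hj => rw [eval_X]; exact hz j hj

theorem isCompact_Omega (hM : ∀ v ∈ D.Omega, ∑ k, v k ^ 2 < D.M) : IsCompact D.Omega := by
  have hcl : IsClosed D.Omega := by
    rw [← D.solutionSet_constraints hM]
    have : solutionSet D.constraints =
        ⋂ (p : MvPolynomial (Var n t m) ℝ) (k : ℕ) (_ : (p, k) ∈ D.constraints),
          {v | 0 ≤ eval v p} := by
      ext v
      simp [solutionSet]
    rw [this]
    exact isClosed_iInter fun p => isClosed_iInter fun _ => isClosed_iInter fun _ =>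
      isClosed_le continuous_const (continuous_eval p)
  refine (isCompact_univ_pi fun _ : Var n t m =>
    isCompact_Icc (a := -√D.M) (b := √D.M)).of_isClosed_subset hcl fun v hv s _ => ?_
  refine abs_le.1 (Real.abs_le_sqrt ?_)
  exact (Finset.single_le_sum (f := fun s => v s ^ 2) (fun _ _ => sq_nonneg _)
    (Finset.mem_univ s)).trans (hM v hv).le

theorem image_eq_image_Omega {f : D.K → ℝ} {S : Set D.K} (hS : S = D.projectedSet)
    (hf : {p : D.K × ℝ | p.2 = f p.1} = D.projectedGraph) :
    f '' S = (fun v => v (zVar n t (Fin.last m))) '' D.Omega := by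
  ext ρ
  constructor
  · rintro ⟨x, hx, rfl⟩
    rw [hS] at hx
    obtain ⟨y, hu, hy⟩ := hx
    have hz : (x, f x) ∈ D.projectedGraph := by
      rw [← hf]
      exact rfl
    obtain ⟨z, hzl, hq, hz⟩ := hz
    refine ⟨Sum.elim x.1 (Sum.elim y z), ⟨fun j => ?_, fun k => ?_, fun l => ?_, hy, hz⟩, hzl⟩
    · rw [gLift, eval_rename, Sum.elim_comp_inl]
      exact x.2 j
    · rw [uLift, eval_rename, Sum.elim_comp_map, Sum.elim_comp_inl]
      exact hu k
    · rw [qLift, eval_rename, Sum.elim_comp_map, Sum.elim_comp_inr]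
      exact hq l
  · rintro ⟨v, ⟨hg, hu, hq, hy, hz⟩, rfl⟩
    simp only [gLift, uLift, qLift, eval_rename] at hg hu hq
    have hcomp : ∀ {τ : Type} (φ : τ → Fin t ⊕ Fin (m + 1)),
        v ∘ Sum.map id φ = Sum.elim (v ∘ Sum.inl) (v ∘ Sum.inr ∘ φ) := by
      intro τ φ
      funext s
      cases s <;> rfl
    simp only [hcomp] at hu hq
    have hx : (⟨v ∘ Sum.inl, hg⟩ : D.K) ∈ S := by
      rw [hS]
      exact ⟨_, hu, hy⟩
    refine ⟨⟨v ∘ Sum.inl, hg⟩, hx, ?_⟩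
    have hmem : ((⟨v ∘ Sum.inl, hg⟩ : D.K), v (zVar n t (Fin.last m))) ∈ D.projectedGraph :=
      ⟨_, rfl, hq, hz⟩
    rw [← hf] at hmem
    exact hmem.symm

section Relaxation

variable {D}

theorem exists_isOptimal (hM : ∀ v ∈ D.Omega, ∑ k, v k ^ 2 < D.M) (hne : D.Omega.Nonempty)
    {i : ℕ} (hi : D.c ≤ i) : ∃ w, D.IsOptimal i w := by
  have hc := D.one_le_c
  obtain ⟨w, hw, hmin⟩ := exists_isLeast_satisfiesUpTo (Q := D.constraints) (i := i) (R := D.M)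
    (γ := Finsupp.single (zVar n t (Fin.last m)) 1)
    (fun p k hp => (D.totalDegree_constraint_le hp).1) IsConstraint.one IsConstraint.theta
    (by rwa [D.solutionSet_constraints hM]) (by rw [Finsupp.degree_single]; omega)
  exact ⟨w, (D.feasible_iff_satisfiesUpTo hi).2 hw,
    fun w' hw' => hmin w' ((D.feasible_iff_satisfiesUpTo hi).1 hw')⟩

theorem IsOptimal.isLeast {i : ℕ} {w : (Var n t m →₀ ℕ) → ℝ} (hw : D.IsOptimal i w) :
    IsLeast (objective '' {w | D.Feasible i w}) (objective w) :=
  ⟨⟨w, hw.1, rfl⟩, by rintro _ ⟨w', hw', rfl⟩; exact hw.2 w' hw'⟩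

theorem IsOptimal.rho_eq {i : ℕ} {w : (Var n t m →₀ ℕ) → ℝ} (hw : D.IsOptimal i w) :
    D.rho i = objective w := hw.isLeast.csInf_eq

theorem IsOptimal.objective_le (hM : ∀ v ∈ D.Omega, ∑ k, v k ^ 2 < D.M) {i : ℕ} (hi : D.c ≤ i)
    {w : (Var n t m →₀ ℕ) → ℝ} (hw : D.IsOptimal i w) {v : Var n t m → ℝ} (hv : v ∈ D.Omega) :
    objective w ≤ v (zVar n t (Fin.last m)) := by
  rw [← D.solutionSet_constraints hM] at hv
  have := hw.2 _ ((D.feasible_iff_satisfiesUpTo hi).2 (satisfiesUpTo_eval hv i))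
  refine this.trans_eq ?_
  exact eval_X _

theorem Feasible.mono {i j : ℕ} (hi : D.c ≤ i) (hij : i ≤ j) {w : (Var n t m →₀ ℕ) → ℝ}
    (hw : D.Feasible j w) : D.Feasible i w :=
  (D.feasible_iff_satisfiesUpTo hi).2
    (((D.feasible_iff_satisfiesUpTo (hi.trans hij)).1 hw).mono hij)

theorem monotoneOn_rho (hM : ∀ v ∈ D.Omega, ∑ k, v k ^ 2 < D.M) (hne : D.Omega.Nonempty) :
    MonotoneOn D.rho (Set.Ici D.c) := by
  intro i hi j hj hij
  obtain ⟨w, hw⟩ := exists_isOptimal hM hne hi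
  obtain ⟨w', hw'⟩ := exists_isOptimal hM hne hj
  rw [hw.rho_eq, hw'.rho_eq]
  exact hw.2 _ (hw'.1.mono hi hij)

theorem tendsto_rho (hM : ∀ v ∈ D.Omega, ∑ k, v k ^ 2 < D.M) {ρ : ℝ}
    (hρ : IsLeast ((fun v => v (zVar n t (Fin.last m))) '' D.Omega) ρ) :
    Tendsto D.rho atTop (𝓝 ρ) := by
  obtain ⟨⟨v, hv, rfl⟩, hmin⟩ := hρ
  refine tendsto_order.2 ⟨fun ρ hρ => ?_, fun ρ hρ => ?_⟩
  · obtain ⟨i, -, hi⟩ := exists_order_lt_of_satisfiesUpTo (Q := D.constraints) (R := D.M)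
      (fun p k hp => (D.totalDegree_constraint_le hp).1) IsConstraint.one IsConstraint.theta
      (zVar n t (Fin.last m)) (ρ := ρ) (by
        rw [D.solutionSet_constraints hM]
        exact fun v' hv' => hρ.trans_le (hmin ⟨v', hv', rfl⟩))
    filter_upwards [eventually_ge_atTop (max i D.c)] with j hj
    obtain ⟨w, hw⟩ := exists_isOptimal hM ⟨v, hv⟩ ((le_max_right _ _).trans hj)
    rw [hw.rho_eq]
    exact hi w (((D.feasible_iff_satisfiesUpTo ((le_max_right _ _).trans hj)).1 hw.1).mono
      ((le_max_left _ _).trans hj))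
  · filter_upwards [eventually_ge_atTop D.c] with j hj
    obtain ⟨w, hw⟩ := exists_isOptimal hM ⟨v, hv⟩ hj
    rw [hw.rho_eq]
    exact (hw.objective_le hM hj hv).trans_lt hρ

theorem IsOptimal.flat (hM : ∀ v ∈ D.Omega, ∑ k, v k ^ 2 < D.M) {ρ : ℝ}
    (hρ : IsLeast ((fun v => v (zVar n t (Fin.last m))) '' D.Omega) ρ) {i d : ℕ} (hi : D.c ≤ i)
    {w : (Var n t m →₀ ℕ) → ℝ} (hw : D.IsOptimal i w) (hd : (momentMatrix i w).rank = d)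
    (hd' : (momentMatrix (i - D.c) w).rank = d) :
    D.rho i = ρ ∧ ∃ μ : Measure (Var n t m → ℝ), IsAtomicProbability μ d D.Omega ∧
      ∀ α : Var n t m →₀ ℕ, α.degree ≤ 2 * i → w α = ∫ v, ∏ k, v k ^ α k ∂μ := by
  have hc := D.one_le_c
  obtain ⟨T, c, rfl, hpos, hsum, hT, hL⟩ := exists_atoms_mem_solutionSet hc hi
    (fun p k hp => D.totalDegree_constraint_le hp) IsConstraint.one
    ((D.feasible_iff_satisfiesUpTo hi).1 hw.1) hd hd'
  rw [D.solutionSet_constraints hM] at hT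
  refine ⟨?_, ?_⟩
  · rw [hw.rho_eq]
    obtain ⟨⟨v, hv, rfl⟩, hmin⟩ := hρ
    refine le_antisymm (hw.objective_le hM hi hv) ?_
    rw [objective, ← riesz_X w, hL _ (by rw [totalDegree_X]; omega)]
    calc _ = ∑ v' ∈ T, c v' * v (zVar n t (Fin.last m)) := by
          rw [← Finset.sum_mul, hsum, one_mul]
      _ ≤ _ := Finset.sum_le_sum fun v' hv' => by
          rw [eval_X]
          exact mul_le_mul_of_nonneg_left (hmin ⟨v', hT hv', rfl⟩) (hpos v' hv').le
  · obtain ⟨μ, hμ, hint⟩ := exists_isAtomicProbability hpos hsum hT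
    refine ⟨μ, hμ, fun α hα => ?_⟩
    rw [hint, ← riesz_monomial_one w, hL _ ((totalDegree_monomial_le_degree _ _).trans hα)]
    refine Finset.sum_congr rfl fun v _ => ?_
    rw [eval_monomial, one_mul, Finsupp.prod_fintype _ _ fun _ => pow_zero _]

end Relaxation

end LiftedData

end MomentRelaxation

end

theorem mainTheorem4 {n t m a r b s : ℕ}
    (D : MomentRelaxation.LiftedData n t m a r b)
    -- the original problem: minimize `f` over `S = {x ∈ K : h_ℓ(x) ≥ 0}`, with `f, h_ℓ ∈ 𝒜`
    (h : Fin s → D.K → ℝ) (hh : ∀ l, MomentRelaxation.InAlgebra D.K (h l))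
    (f : D.K → ℝ) (hf : MomentRelaxation.InAlgebra D.K f)
    (S : Set D.K) (hS : S = {x | ∀ l, 0 ≤ h l x}) (hne : S.Nonempty)
    -- the data describe a lifting of `S` and a lifting of the graph of `f`
    (hSlift : S = D.projectedSet)
    (hflift : {p : D.K × ℝ | p.2 = f p.1} = D.projectedGraph)
    -- `M > ‖(x,y,z)‖²` on `Ω`
    (hM : ∀ v ∈ D.Omega, ∑ k, v k ^ 2 < D.M)
    (fstar : ℝ) (hfstar : fstar = sInf (f '' S)) :
    -- `f*` is a minimum, and is the minimum of the lifted polynomial problem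
    IsLeast (f '' S) fstar ∧
    IsLeast ((fun v => v (MomentRelaxation.LiftedData.zVar n t (Fin.last m))) '' D.Omega) fstar ∧
    -- the relaxations attain their optimal values, which increase to `f*`
    (∀ i, D.c ≤ i →
      IsLeast (MomentRelaxation.LiftedData.objective '' {w | D.Feasible i w}) (D.rho i)) ∧
    MonotoneOn D.rho (Set.Ici D.c) ∧
    Tendsto D.rho atTop (𝓝 fstar) ∧
    -- finite convergence under the flat rank condition
    (∀ i, D.c ≤ i → ∀ w, D.IsOptimal i w → ∀ d : ℕ,
      (MomentRelaxation.momentMatrix i w).rank = d →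
      (MomentRelaxation.momentMatrix (i - D.c) w).rank = d →
      D.rho i = fstar ∧
      ∃ μ : Measure (MomentRelaxation.Var n t m → ℝ),
        MomentRelaxation.IsAtomicProbability μ d D.Omega ∧
        ∀ α : MomentRelaxation.Var n t m →₀ ℕ, α.degree ≤ 2 * i →
          w α = ∫ v, ∏ k, v k ^ α k ∂μ) := by
  have himage := D.image_eq_image_Omega hSlift hflift
  have hOne : D.Omega.Nonempty := by
    have := hne.image f
    rw [himage] at this
    exact this.of_image
  have hleast : IsLeast
      ((fun v => v (MomentRelaxation.LiftedData.zVar n t (Fin.last m))) '' D.Omega) fstar := by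
    rw [hfstar, himage]
    exact ((D.isCompact_Omega hM).image (continuous_apply _)).isLeast_sInf (hOne.image _)
  refine ⟨himage ▸ hleast, hleast, fun i hi => ?_,
    MomentRelaxation.LiftedData.monotoneOn_rho hM hOne,
    MomentRelaxation.LiftedData.tendsto_rho hM hleast,
    fun i hi w hw d hd hd' => hw.flat hM hleast hi hd hd'⟩
  obtain ⟨w, hw⟩ := MomentRelaxation.LiftedData.exists_isOptimal hM hOne hi
  rw [hw.rho_eq]
  exact hw.isLeast
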